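/- All vector spaces are real and finite-dimensional. An $\mathcal{LA}$-Courant algebroid over a point consists of a double vector bundle $$\begin{array}{ccc}\mathbb{A}&\to& V\\ \downarrow&&\downarrow\\ \ast&\to&\ast\end{array}$$ together with the structure of a Courant algebroid on $\mathbb{A}\to\ast$ (a bracket and a non-degenerate symmetric pairing) and of a Lie algebroid on $\mathbb{A}\to V$, such that: (a) the graph of the addition of $\mathbb{A}\to V$ is a Courant relation $\mathbb{A}\times\mathbb{A}\dashrightarrow\mathbb{A}$; (b) the graph of the addition of the vector space $\mathbb{A}$ is a Lie subalgebroid of $(\mathbb{A}\to V)^3$; (c) if $\pi^\sharp:T^*(\mathbb{A}^*_V)\to T(\mathbb{A}^*_V)$ is the anchor of the linear Poisson structure on the dual $\mathbb{A}^*_V$ of $\mathbb{A}\to V$, then the relation $\Pi_{\mathbb{A}}:T\mathbb{A}\dashrightarrow T\mathbb{A}$ which is the annihilator of the graph of $\pi^\sharp$ (dualizing $T^*(\mathbb{A}^*_V)\cong T^*\mathbb{A}$ over $\mathbb{A}$ and $T(\mathbb{A}^*_V)$ over $TV$) is a Courant relation for the tangent prolongation of $\mathbb{A}$. An $\mathcal{LA}$-Dirac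 structure is a double vector subbundle $L\subseteq\mathbb{A}$ which is a Dirac structure of $\mathbb{A}\to\ast$ and a Lie subalgebroid of $\mathbb{A}\to V$. For a Lie algebra $\mathfrak{g}$ and an invariant symmetric bilinear form $\beta\in S^2(\mathfrak{g})^{\mathfrak{g}}$ on $\mathfrak{g}^*$, let $\beta^\sharp:\mathfrak{g}^*\to\mathfrak{g}$, $\beta^\sharp(\mu)=\beta(\mu,\cdot)$, and let $\mathbb{A}_{\mathfrak{g},\beta}=\mathfrak{g}\ltimes\mathfrak{g}^*$ with side bundle $V=\mathfrak{g}$, the semidirect product bracket for the coadjoint action, the natural pairing, and the Lie algebroid structure over $\mathfrak{g}$ of the action Lie algebroid of the abelian Lie algebra $\mathfrak{g}^*$ acting on $\mathfrak{g}$ by the constant vector fields $\beta^\sharp(\mu)$. **Proposition.** (1) Each $\mathbb{A}_{\mathfrak{g},\beta}$ is an $\mathcal{LA}$-Courant algebroid over a point, and every $\mathcal{LA}$-Courant algebroid over a point is isomorphic to some $\mathbb{A}_{\mathfrak{g},\beta}$. The isomorphisms $\mathbb{A}_{\mathfrak{g},\beta}\to\mathbb{A}_{\mathfrak{g}',\beta'}$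 are exactly the maps $(x,\mu)\mapsto(\varphi(x),\mu\circ\varphi^{-1})$, covering $\varphi$, for the Lie algebra isomorphisms $\varphi:\mathfrak{g}\to\mathfrak{g}'$ carrying $\beta$ to $\beta'$. Thus $\mathcal{LA}$-Courant algebroids over a point are in one-to-one correspondence with pairs $(\mathfrak{g},\beta)$, up to isomorphism. (2) A subset $L\subseteq\mathbb{A}_{\mathfrak{g},\beta}$ is an $\mathcal{LA}$-Dirac structure if and only if $L=\mathfrak{h}\ltimes\operatorname{ann}(\mathfrak{h})$ for a (necessarily unique) Lie subalgebra $\mathfrak{h}\subseteq\mathfrak{g}$ which is $\beta$-coisotropic, i.e. $\beta^\sharp(\operatorname{ann}(\mathfrak{h}))\subseteq\mathfrak{h}$. -/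

import Mathlib

universe u v w

open scoped ContDiff

noncomputable section

namespace LACourant

/-! ### Calculus on finite-dimensional real vector spaces

Every finite-dimensional real vector space carries its canonical smooth structure: the
one for which linear coordinates are smooth. -/

section Calculus

/-- Linear coordinates on a finite-dimensional real vector space. -/
def coords (E : Type*) [AddCommGroup E] [Module ℝ E] [FiniteDimensional ℝ E] :
    E ≃ₗ[ℝ] (Fin (Module.finrank ℝ E) → ℝ) :=
  (Module.finBasis ℝ E).equivFun

variable {E F : Type*} [AddCommGroup E] [Module ℝ E] [FiniteDimensional ℝ E]
  [AddCommGroup F] [Module ℝ F] [FiniteDimensional ℝ F]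

/-- Open subsets for the canonical topology of a finite-dimensional real vector space. -/
def IsOpenSet (U : Set E) : Prop := IsOpen ((coords E).symm ⁻¹' U)

/-- Smoothness of a map on a subset of a finite-dimensional real vector space. -/
def SmoothOn (f : E → F) (s : Set E) : Prop :=
  ContDiffOn ℝ ∞ (fun x => coords F (f ((coords E).symm x))) ((coords E).symm ⁻¹' s)

/-- Smooth maps between finite-dimensional real vector spaces. -/
def Smooth (f : E → F) : Prop :=
  ContDiff ℝ ∞ (fun x => coords F (f ((coords E).symm x)))

/-- The derivative of `f` at `x` in the direction `h`. -/
def dirDeriv (f : E → F) (x h : E) : F :=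
  (coords F).symm (lineDeriv ℝ (fun y => coords F (f y)) x h)

/-- The vectors tangent at `p` to the subset (submanifold) `N`: velocities of smooth curves
that stay in `N`. -/
def tangentVectors (N : Set E) (p : E) : Set E :=
  {h | ∃ γ : ℝ → E, Smooth γ ∧ (∀ t, γ t ∈ N) ∧ γ 0 = p ∧ dirDeriv γ 0 1 = h}

/-- `N` is coisotropic in the manifold `E` for the bivector field `π`: at every point of `N`,
`π` vanishes on pairs of covectors which annihilate the tangent space of `N`. Here `Cov` is
a model of the space of covectors, with evaluation `ev`. -/
def IsCoisotropic {Cov : Type*} (ev : Cov → E → ℝ) (π : E → Cov → Cov → ℝ) (N : Set E) :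
    Prop :=
  ∀ p ∈ N, ∀ α α' : Cov,
    (∀ h ∈ tangentVectors N p, ev α h = 0) → (∀ h ∈ tangentVectors N p, ev α' h = 0) →
      π p α α' = 0

lemma smooth_of_linear (f : E →ₗ[ℝ] F) : Smooth f :=
  (LinearMap.toContinuousLinearMap
    ((coords F).toLinearMap ∘ₗ f ∘ₗ (coords E).symm.toLinearMap)).contDiff

end Calculus

/-! ### Courant algebroids over a point -/

/-- A bilinear form and a bilinear bracket on a vector space. -/
structure MetricBracket (E : Type*) [AddCommGroup E] [Module ℝ E] where
  metric : LinearMap.BilinForm ℝ E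
  bracket : E →ₗ[ℝ] E →ₗ[ℝ] E

namespace MetricBracket

variable {E F : Type*} [AddCommGroup E] [Module ℝ E] [AddCommGroup F] [Module ℝ F]

/-- The axioms of a Courant algebroid over a point (the anchor takes values in the zero
vector space). -/
structure IsCourantAlgebroid (Q : MetricBracket E) : Prop where
  metric_symm : ∀ x y, Q.metric x y = Q.metric y x
  metric_nondegenerate : ∀ x, (∀ y, Q.metric x y = 0) → x = 0
  jacobi : ∀ x y z, Q.bracket x (Q.bracket y z) =
    Q.bracket (Q.bracket x y) z + Q.bracket y (Q.bracket x z)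
  metric_invariant : ∀ x y z, 0 = Q.metric (Q.bracket x y) z + Q.metric y (Q.bracket x z)
  bracket_add_swap : ∀ x y, Q.bracket x y + Q.bracket y x = 0

/-- The same bracket, with the metric negated. -/
def bar (Q : MetricBracket E) : MetricBracket E := ⟨-Q.metric, Q.bracket⟩

/-- The direct product. -/
def prod (Q : MetricBracket E) (R : MetricBracket F) : MetricBracket (E × F) where
  metric := LinearMap.mk₂ ℝ (fun x y => Q.metric x.1 y.1 + R.metric x.2 y.2)
    (by intros; simp; ring) (by intros; simp; ring) (by intros; simp; ring)
    (by intros; simp; ring)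
  bracket := LinearMap.mk₂ ℝ (fun x y => (Q.bracket x.1 y.1, R.bracket x.2 y.2))
    (by intros; ext <;> simp) (by intros; ext <;> simp) (by intros; ext <;> simp)
    (by intros; ext <;> simp)

/-- The tangent prolongation, on `TE = E × E` (pairs of a base point and a velocity): `(x, 0)`
is the tangent lift of `x` and `(0, x)` is its core lift. -/
def tangent (Q : MetricBracket E) : MetricBracket (E × E) where
  metric := LinearMap.mk₂ ℝ (fun x y => Q.metric x.1 y.2 + Q.metric x.2 y.1)
    (by intros; simp; ring) (by intros; simp; ring) (by intros; simp; ring)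
    (by intros; simp; ring)
  bracket := LinearMap.mk₂ ℝ
    (fun x y => (Q.bracket x.1 y.1, Q.bracket x.1 y.2 + Q.bracket x.2 y.1))
    (by intros; ext <;> simp; abel) (by intros; ext <;> simp)
    (by intros; ext <;> simp; abel) (by intros; ext <;> simp)

/-- Dirac structures: `L` equals its orthogonal complement (so that it is a linear subspace) and
is closed under the bracket. -/
structure IsDirac (Q : MetricBracket E) (L : Set E) : Prop where
  lagrangian : ∀ x, x ∈ L ↔ ∀ y ∈ L, Q.metric x y = 0
  involutive : ∀ x ∈ L, ∀ y ∈ L, Q.bracket x y ∈ L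

/-- Courant relations from `Q` to `R`; the elements of `rel` are pairs (target, source). -/
def IsCourantRelation (Q : MetricBracket E) (R : MetricBracket F) (rel : Set (F × E)) :
    Prop :=
  (R.prod Q.bar).IsDirac rel

end MetricBracket

/-! ### Double vector bundles over a point -/

/-- A double vector bundle with sides `V` and `A = M = pt`: the total space `𝔸` is a vector
space (a vector bundle over `A`) and, by means of a linear map `proj`, a smooth vector bundle
over `V`, and the two structures satisfy the interchange laws. -/
structure DoubleVB (V : Type*) (𝔸 : Type*)
    [AddCommGroup V] [Module ℝ V] [FiniteDimensional ℝ V]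
    [AddCommGroup 𝔸] [Module ℝ 𝔸] [FiniteDimensional ℝ 𝔸] where
  proj : 𝔸 →ₗ[ℝ] V
  fibreAddCommGroup : ∀ v, AddCommGroup {d : 𝔸 // proj d = v}
  fibreModule : ∀ v, Module ℝ {d : 𝔸 // proj d = v}
  locally_trivial : ∀ v₀ : V, ∃ (U : Set V) (n : ℕ)
    (φ : ∀ v, {d : 𝔸 // proj d = v} ≃ₗ[ℝ] (Fin n → ℝ)),
    IsOpenSet U ∧ v₀ ∈ U ∧
    SmoothOn (fun d : 𝔸 => φ (proj d) ⟨d, rfl⟩) (proj ⁻¹' U) ∧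
    SmoothOn (fun p : V × (Fin n → ℝ) => ((φ p.1).symm p.2 : 𝔸)) (U ×ˢ Set.univ)
  add_interchange : ∀ (v v' : V) (x y : {d : 𝔸 // proj d = v}) (x' y' : {d : 𝔸 // proj d = v'}),
    ((x + y : {d : 𝔸 // proj d = v}) : 𝔸) + (x' + y' : {d : 𝔸 // proj d = v'}) =
      ((⟨x + x', by rw [map_add, x.2, x'.2]⟩ + ⟨y + y', by rw [map_add, y.2, y'.2]⟩ :
        {d : 𝔸 // proj d = v + v'}) : 𝔸)
  smul_interchange : ∀ (t : ℝ) (v : V) (x y : {d : 𝔸 // proj d = v}),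
    t • ((x + y : {d : 𝔸 // proj d = v}) : 𝔸) =
      ((⟨t • (x : 𝔸), by rw [map_smul, x.2]⟩ + ⟨t • (y : 𝔸), by rw [map_smul, y.2]⟩ :
        {d : 𝔸 // proj d = t • v}) : 𝔸)
  fibre_smul_interchange : ∀ (t : ℝ) (v v' : V) (x : {d : 𝔸 // proj d = v})
    (x' : {d : 𝔸 // proj d = v'}),
    ((t • ⟨x + x', by rw [map_add, x.2, x'.2]⟩ : {d : 𝔸 // proj d = v + v'}) : 𝔸) =
      (t • x : {d : 𝔸 // proj d = v}) + (t • x' : {d : 𝔸 // proj d = v'})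

namespace DoubleVB

variable {V : Type*} {𝔸 : Type*} [AddCommGroup V] [Module ℝ V] [FiniteDimensional ℝ V]
  [AddCommGroup 𝔸] [Module ℝ 𝔸] [FiniteDimensional ℝ 𝔸]

/-- The fibre of `𝔸 → V` over `v`. -/
abbrev Fibre (D : DoubleVB V 𝔸) (v : V) : Type _ := {d : 𝔸 // D.proj d = v}

instance (D : DoubleVB V 𝔸) (v : V) : AddCommGroup (D.Fibre v) := D.fibreAddCommGroup v

instance (D : DoubleVB V 𝔸) (v : V) : Module ℝ (D.Fibre v) := D.fibreModule v

/-- Smooth sections of `𝔸 → V`. -/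
def IsSmoothSection (D : DoubleVB V 𝔸) (σ : ∀ v, D.Fibre v) : Prop :=
  Smooth (fun v => (σ v : 𝔸))

/-- The core. -/
abbrev Core (D : DoubleVB V 𝔸) : Submodule ℝ 𝔸 := LinearMap.ker D.proj

/-- The core component of `d`, namely the difference in the vector space `𝔸` of `d` and the
zero element of the fibre through `d`. This identifies each fibre of `𝔸 → V` with the core. -/
def corePart (D : DoubleVB V 𝔸) (d : 𝔸) : D.Core :=
  ⟨d - ((0 : D.Fibre (D.proj d)) : 𝔸), by
    rw [LinearMap.mem_ker, map_sub, (0 : D.Fibre (D.proj d)).2, sub_self]⟩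

/-- The section of `𝔸 → V` defined by an element of the core, `v ↦ 0_v + c`. -/
def coreSection (D : DoubleVB V 𝔸) (c : D.Core) (v : V) : D.Fibre v :=
  ⟨((0 : D.Fibre v) : 𝔸) + c, by
    rw [map_add, (0 : D.Fibre v).2, LinearMap.mem_ker.mp c.2, add_zero]⟩

/-- The graph of the addition of `𝔸 → V`, as a relation from `𝔸 × 𝔸` to `𝔸`. -/
def graphFibreAdd (D : DoubleVB V 𝔸) : Set (𝔸 × (𝔸 × 𝔸)) :=
  {z | ∃ (v : V) (x y : D.Fibre v), z = (((x + y : D.Fibre v) : 𝔸), ((x : 𝔸), (y : 𝔸)))}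

/-- Double vector subbundles: subsets closed under both vector bundle structures.
(Such a subset is a vector subspace `L` of `𝔸`, and is the sum of the zero section over
`W = proj L` and of a subspace of the core, hence a smooth subbundle over `W`.) -/
structure IsSubbundle (D : DoubleVB V 𝔸) (L : Set 𝔸) : Prop where
  zero_mem : (0 : 𝔸) ∈ L
  add_mem : ∀ x ∈ L, ∀ y ∈ L, x + y ∈ L
  smul_mem : ∀ (t : ℝ), ∀ x ∈ L, t • x ∈ L
  fibre_add_mem : ∀ (v : V) (x y : D.Fibre v), (x : 𝔸) ∈ L → (y : 𝔸) ∈ L →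
    ((x + y : D.Fibre v) : 𝔸) ∈ L
  fibre_smul_mem : ∀ (t : ℝ) (v : V) (x : D.Fibre v), (x : 𝔸) ∈ L →
    ((t • x : D.Fibre v) : 𝔸) ∈ L

/-- The total space of the dual of `𝔸 → V`: the fibre over `v` is the dual of the core, by the
identification of the fibres of `𝔸 → V` with the core. Its tangent space at every point is the
same vector space. -/
abbrev DualBundle (D : DoubleVB V 𝔸) : Type _ := V × Module.Dual ℝ D.Core

/-- The covectors on the total space of the dual of `𝔸 → V`, at any point. -/
abbrev DualCovector (D : DoubleVB V 𝔸) : Type _ := Module.Dual ℝ V × D.Core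

/-- The evaluation of covectors on tangent vectors of the dual of `𝔸 → V`. -/
def covEval (D : DoubleVB V 𝔸) (p : D.DualCovector) (h : D.DualBundle) : ℝ :=
  p.1 h.1 + h.2 p.2

/-- The annihilator, in the dual of `𝔸 → V`, of a subbundle `L → proj L`. -/
def annihilator (D : DoubleVB V 𝔸) (L : Set 𝔸) : Set D.DualBundle :=
  {p | p.1 ∈ D.proj '' L ∧ ∀ d ∈ L, D.proj d = p.1 → p.2 (D.corePart d) = 0}

/-- The annihilator, in the third power of the dual of `𝔸 → V`, of the graph
`{(d + d'; d, d')}` of the addition of the vector space `𝔸`. -/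
def annihilatorGraphAdd (D : DoubleVB V 𝔸) :
    Set (D.DualBundle × D.DualBundle × D.DualBundle) :=
  {p | p.1.1 = p.2.1.1 + p.2.2.1 ∧ ∀ d d' : 𝔸, D.proj d = p.2.1.1 → D.proj d' = p.2.2.1 →
    p.1.2 (D.corePart (d + d')) + p.2.1.2 (D.corePart d) + p.2.2.2 (D.corePart d') = 0}

/-- The pairing of `T𝔸 → TV` with the tangent bundle of the dual of `𝔸 → V`: the derivative
of the pairing of `𝔸` with its dual. The tangent vectors are `(b, b')` and `(q, h)`, with equal
images in `TV`. -/
def tangentPairing (D : DoubleVB V 𝔸) (Y : 𝔸 × 𝔸) (Z : D.DualBundle × D.DualBundle) : ℝ :=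
  Z.1.2 (D.corePart Y.2) + Z.2.2 (D.corePart Y.1)

/-- The pairing of `T𝔸 → 𝔸` with the cotangent bundle of the dual of `𝔸 → V`, the latter being
a bundle over `𝔸` by `(q, p) ↦ 0_v + p.2` for `q` over `v`: the pairing of `X` with
`(q, p)` is `⟨X, Z⟩ - p(Z)` for any tangent vector `Z` at `q` with the same image in `TV`
as `X` (here `Z = (q, (proj X.2, 0))`), `⟨X, Z⟩` being the pairing above. -/
def cotangentPairing (D : DoubleVB V 𝔸) (X : 𝔸 × 𝔸) (P : D.DualBundle × D.DualCovector) : ℝ :=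
  D.tangentPairing X (P.1, (D.proj X.2, 0)) - D.covEval P.2 (D.proj X.2, 0)

end DoubleVB

/-! ### LA-Courant algebroids over a point -/

/-- The data of an LA-Courant algebroid over a point: a double vector bundle, a metric and a
bracket on the vector space `𝔸`, and an anchor and a bracket of sections for `𝔸 → V`. (Only the
brackets of smooth sections matter.) -/
structure Data (V : Type*) (𝔸 : Type*)
    [AddCommGroup V] [Module ℝ V] [FiniteDimensional ℝ V]
    [AddCommGroup 𝔸] [Module ℝ 𝔸] [FiniteDimensional ℝ 𝔸] extends DoubleVB V 𝔸 where
  courant : MetricBracket 𝔸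
  anchor : 𝔸 → V
  bracket : (∀ v, toDoubleVB.Fibre v) → (∀ v, toDoubleVB.Fibre v) → ∀ v, toDoubleVB.Fibre v

namespace Data

variable {V : Type*} {𝔸 : Type*} [AddCommGroup V] [Module ℝ V] [FiniteDimensional ℝ V]
  [AddCommGroup 𝔸] [Module ℝ 𝔸] [FiniteDimensional ℝ 𝔸]

/-- `𝔸` is a Courant algebroid over a point, for which the addition of `𝔸 → V` is a Courant
relation from `𝔸 × 𝔸` to `𝔸`. -/
structure IsVBCourant (A : Data V 𝔸) : Prop where
  courantAlgebroid : A.courant.IsCourantAlgebroid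
  graph_add : (A.courant.prod A.courant).IsCourantRelation A.courant A.graphFibreAdd

/-- `𝔸 → V` is a Lie algebroid. -/
structure IsLieAlgebroid (A : Data V 𝔸) : Prop where
  anchor_smooth : Smooth A.anchor
  anchor_add : ∀ (v : V) (x y : A.Fibre v),
    A.anchor (x + y : A.Fibre v) = A.anchor x + A.anchor y
  anchor_smul : ∀ (t : ℝ) (v : V) (x : A.Fibre v), A.anchor (t • x : A.Fibre v) = t • A.anchor x
  bracket_smooth : ∀ σ τ, A.IsSmoothSection σ → A.IsSmoothSection τ →
    A.IsSmoothSection (A.bracket σ τ)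
  bracket_add : ∀ σ τ υ, A.IsSmoothSection σ → A.IsSmoothSection τ → A.IsSmoothSection υ →
    A.bracket σ (τ + υ) = A.bracket σ τ + A.bracket σ υ
  bracket_smul : ∀ (t : ℝ) (σ τ), A.IsSmoothSection σ → A.IsSmoothSection τ →
    A.bracket σ (t • τ) = t • A.bracket σ τ
  bracket_skew : ∀ σ τ, A.IsSmoothSection σ → A.IsSmoothSection τ →
    A.bracket σ τ = -A.bracket τ σ
  jacobi : ∀ σ τ υ, A.IsSmoothSection σ → A.IsSmoothSection τ → A.IsSmoothSection υ →
    A.bracket σ (A.bracket τ υ) = A.bracket (A.bracket σ τ) υ + A.bracket τ (A.bracket σ υ)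
  leibniz : ∀ σ τ (f : V → ℝ), A.IsSmoothSection σ → A.IsSmoothSection τ → Smooth f →
    A.bracket σ (fun v => f v • τ v) =
      fun v => lineDeriv ℝ f v (A.anchor (σ v)) • τ v + f v • A.bracket σ τ v

/-- The bivector field of the linear Poisson structure on the dual of `𝔸 → V`. It is determined by
`{⟨σ, ·⟩, ⟨τ, ·⟩} = ⟨[σ, τ], ·⟩`, `{⟨σ, ·⟩, f} = anchor(σ) f` and `{f, g} = 0` for sections `σ`,
`τ` of `𝔸 → V` and functions `f`, `g` on `V`, where `(α, c)` is the differential at `q` of the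
sum of the linear function of the core section `c` and of the linear function `α` on `V`. -/
def poisson (A : Data V 𝔸) (q : A.DualBundle) (p p' : A.DualCovector) : ℝ :=
  q.2 (A.corePart (A.bracket (A.coreSection p.2) (A.coreSection p'.2) q.1))
    + p'.1 (A.anchor (A.coreSection p.2 q.1)) - p.1 (A.anchor (A.coreSection p'.2 q.1))

/-- A subbundle is a Lie subalgebroid when its annihilator is coisotropic for the linear Poisson
structure on the dual. -/
def IsLieSubalgebroid (A : Data V 𝔸) (L : Set 𝔸) : Prop :=
  IsCoisotropic A.covEval A.poisson (A.annihilator L)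

/-- `𝔸 → V` is a Lie algebroid, and the graph of the addition of the vector space `𝔸` is a Lie
subalgebroid of the third power of `𝔸 → V`. -/
structure IsLAVectorBundle (A : Data V 𝔸) : Prop where
  lieAlgebroid : A.IsLieAlgebroid
  graph_add : IsCoisotropic
    (fun (p : A.DualCovector × A.DualCovector × A.DualCovector) h =>
      A.covEval p.1 h.1 + A.covEval p.2.1 h.2.1 + A.covEval p.2.2 h.2.2)
    (fun q p p' => A.poisson q.1 p.1 p'.1 + A.poisson q.2.1 p.2.1 p'.2.1
      + A.poisson q.2.2 p.2.2 p'.2.2)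
    A.annihilatorGraphAdd

/-- The graph of the anchor map from the cotangent to the tangent bundle of the dual of `𝔸 → V`
given by contraction with the Poisson bivector field, with elements (target, source). -/
def graphSharp (A : Data V 𝔸) :
    Set ((A.DualBundle × A.DualBundle) × (A.DualBundle × A.DualCovector)) :=
  {z | z.1.1 = z.2.1 ∧ ∀ p' : A.DualCovector, A.covEval p' z.1.2 = A.poisson z.2.1 z.2.2 p'}

/-- For `Y`, `X` in `T𝔸` and `z` in the graph above: the two components of `z` lie in the fibres
dual to those of `Y` (over `TV`) and of `X` (over `𝔸`). -/
def Composable (A : Data V 𝔸) (Y X : 𝔸 × 𝔸)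
    (z : (A.DualBundle × A.DualBundle) × (A.DualBundle × A.DualCovector)) : Prop :=
  (z.1.1.1 = A.proj Y.1 ∧ z.1.2.1 = A.proj Y.2) ∧ (A.coreSection z.2.2.2 z.2.1.1 : 𝔸) = X.1

/-- The relation from `T𝔸` (as a bundle over `𝔸`) to `T𝔸` (as a bundle over `TV`) which is the
annihilator of the graph of the Poisson anchor map, consisting of the pairs `(Y, X)` over the
base of that graph with equal pairings on all its elements. -/
def poissonRelation (A : Data V 𝔸) : Set ((𝔸 × 𝔸) × (𝔸 × 𝔸)) :=
  {w | (∃ z ∈ A.graphSharp, A.Composable w.1 w.2 z) ∧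
    ∀ z ∈ A.graphSharp, A.Composable w.1 w.2 z →
      A.tangentPairing w.1 z.1 = A.cotangentPairing w.2 z.2}

/-- LA-Courant algebroids over a point. -/
structure IsLACourant (A : Data V 𝔸) : Prop where
  vbCourant : A.IsVBCourant
  laVectorBundle : A.IsLAVectorBundle
  courantRelation :
    A.courant.tangent.IsCourantRelation A.courant.tangent A.poissonRelation

/-- LA-Dirac structures: double vector subbundles which are Dirac structures for the Courant
algebroid `𝔸 → pt` and Lie subalgebroids of `𝔸 → V`. -/
structure IsLADirac (A : Data V 𝔸) (L : Set 𝔸) : Prop where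
  subbundle : A.IsSubbundle L
  dirac : A.courant.IsDirac L
  lieSubalgebroid : A.IsLieSubalgebroid L

/-- The pair of `Φ` and `φ` is an isomorphism of LA-Courant algebroids over a point. -/
structure IsIso {V' : Type*} {𝔸' : Type*}
    [AddCommGroup V'] [Module ℝ V'] [FiniteDimensional ℝ V']
    [AddCommGroup 𝔸'] [Module ℝ 𝔸'] [FiniteDimensional ℝ 𝔸']
    (A : Data V 𝔸) (A' : Data V' 𝔸') (Φ : 𝔸 ≃ₗ[ℝ] 𝔸') (φ : V ≃ₗ[ℝ] V') : Prop where
  map_proj : ∀ d, A'.proj (Φ d) = φ (A.proj d)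
  map_fibre_add : ∀ (v : V) (x y : A.Fibre v) (x' y' : A'.Fibre (φ v)),
    Φ x = x' → Φ y = y' → Φ (x + y : A.Fibre v) = (x' + y' : A'.Fibre (φ v))
  map_fibre_smul : ∀ (t : ℝ) (v : V) (x : A.Fibre v) (x' : A'.Fibre (φ v)),
    Φ x = x' → Φ (t • x : A.Fibre v) = (t • x' : A'.Fibre (φ v))
  map_metric : ∀ d e, A'.courant.metric (Φ d) (Φ e) = A.courant.metric d e
  map_courant : ∀ d e, A'.courant.bracket (Φ d) (Φ e) = Φ (A.courant.bracket d e)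
  map_anchor : ∀ d, A'.anchor (Φ d) = φ (A.anchor d)
  map_bracket : ∀ (σ τ : ∀ v, A.Fibre v) (σ' τ' : ∀ v', A'.Fibre v'),
    A.IsSmoothSection σ → A.IsSmoothSection τ →
    A'.IsSmoothSection σ' → A'.IsSmoothSection τ' →
    (∀ v, Φ (σ v) = σ' (φ v)) → (∀ v, Φ (τ v) = τ' (φ v)) →
    ∀ v, Φ (A.bracket σ τ v) = A'.bracket σ' τ' (φ v)

end Data

/-! ### The LA-Courant algebroid of a Lie algebra with an invariant symmetric form -/

section Model

/-- The fibres of the projection `V × C → V` are copies of `C`. -/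
def directSumFibre (V C : Type*) [AddCommGroup V] [Module ℝ V] [AddCommGroup C] [Module ℝ C]
    (v : V) : {d : V × C // LinearMap.fst ℝ V C d = v} ≃ C where
  toFun d := d.1.2
  invFun c := ⟨(v, c), rfl⟩
  left_inv d := by
    obtain ⟨⟨a, c⟩, rfl⟩ := d
    rfl
  right_inv _ := rfl

/-- The double vector bundle `V × C → V` over a point, with core `C`. -/
def DoubleVB.directSum (V C : Type*)
    [AddCommGroup V] [Module ℝ V] [FiniteDimensional ℝ V]
    [AddCommGroup C] [Module ℝ C] [FiniteDimensional ℝ C] : DoubleVB V (V × C) where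
  proj := LinearMap.fst ℝ V C
  fibreAddCommGroup v := (directSumFibre V C v).addCommGroup
  fibreModule v := (directSumFibre V C v).module ℝ
  locally_trivial v₀ := by
    let := fun v => (directSumFibre V C v).addCommGroup
    let := fun v => (directSumFibre V C v).module ℝ
    refine ⟨Set.univ, Module.finrank ℝ C,
      fun v => ((directSumFibre V C v).linearEquiv ℝ).trans (coords C), ?_, trivial, ?_, ?_⟩
    · simp [IsOpenSet]
    · exact ContDiff.contDiffOn
        (smooth_of_linear ((coords C).toLinearMap ∘ₗ LinearMap.snd ℝ V C))
    · exact ContDiff.contDiffOn (smooth_of_linear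
        ((LinearMap.id : V →ₗ[ℝ] V).prodMap (coords C).symm.toLinearMap))
  add_interchange v v' x y x' y' := by
    obtain ⟨⟨a, c⟩, rfl⟩ := x
    obtain ⟨⟨a', c'⟩, rfl⟩ := x'
    obtain ⟨⟨b, d⟩, hb⟩ := y
    obtain ⟨⟨b', d'⟩, hb'⟩ := y'
    exact Prod.ext rfl (add_add_add_comm c d c' d')
  smul_interchange t v x y := Prod.ext rfl (smul_add t x.1.2 y.1.2)
  fibre_smul_interchange t v v' x x' := Prod.ext rfl (smul_add t x.1.2 x'.1.2)

variable (𝔤 : Type*) [LieRing 𝔤] [LieAlgebra ℝ 𝔤] [FiniteDimensional ℝ 𝔤]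

/-- The semidirect product of `𝔤` with the coadjoint representation, with the bilinear form given
by the natural pairing. -/
def semidirect : MetricBracket (𝔤 × Module.Dual ℝ 𝔤) where
  metric := LinearMap.mk₂ ℝ (fun d e => d.2 e.1 + e.2 d.1)
    (by intros; simp; ring) (by intros; simp; ring) (by intros; simp; ring)
    (by intros; simp; ring)
  bracket := LinearMap.mk₂ ℝ (fun d e => (⁅d.1, e.1⁆, ⁅d.1, e.2⁆ - ⁅e.1, d.2⁆))
    (by intros; ext <;> simp; ring) (by intros; ext <;> simp; ring)
    (by intros; ext <;> simp; ring) (by intros; ext <;> simp; ring)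

variable {𝔤}

/-- The map from `𝔤*` to `𝔤` defined by a bilinear form on `𝔤*`, so that
`ν (sharp β μ) = β μ ν`. -/
def sharp (β : LinearMap.BilinForm ℝ (Module.Dual ℝ 𝔤)) : Module.Dual ℝ 𝔤 →ₗ[ℝ] 𝔤 :=
  (Module.evalEquiv ℝ 𝔤).symm.toLinearMap ∘ₗ β

variable (𝔤)

/-- The semidirect product of `𝔤` and `𝔤*` over a point, which as a bundle over `𝔤` is the action
Lie algebroid of the abelian Lie algebra `𝔤*`, acting on `𝔤` by the constant vector fields
`sharp β μ`. -/
def model (β : LinearMap.BilinForm ℝ (Module.Dual ℝ 𝔤)) : Data 𝔤 (𝔤 × Module.Dual ℝ 𝔤) where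
  toDoubleVB := DoubleVB.directSum 𝔤 (Module.Dual ℝ 𝔤)
  courant := semidirect 𝔤
  anchor d := sharp β d.2
  bracket σ τ v := ⟨(v, dirDeriv (fun x => (τ x).1.2) v (sharp β (σ v).1.2)
    - dirDeriv (fun x => (σ x).1.2) v (sharp β (τ v).1.2)), rfl⟩

variable {𝔤}

/-- A Lie subalgebra is coisotropic for `β` if `sharp β` maps its annihilator into it. -/
def IsCoisotropicSubalgebra (β : LinearMap.BilinForm ℝ (Module.Dual ℝ 𝔤))
    (𝔥 : LieSubalgebra ℝ 𝔤) : Prop :=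
  ∀ μ ∈ 𝔥.toSubmodule.dualAnnihilator, sharp β μ ∈ 𝔥

end Model

end LACourant

end

/-! Over a point the splitting is canonical. The interchange laws make the zero section `V → 𝔸`
linear, so `𝔸 = V ⊕ C` with `C` the core, and the operations in each fibre are those of `C`
translated by the zero section (`coe_add`, `coe_smul`). In this splitting every graph occurring in
the axioms is a linear subspace, and each axiom becomes linear algebra.

That fibre addition is a Courant relation makes `V` and `C` isotropic, `V` closed under the bracket,
`[V, C] ⊆ C` and `[C, C] = 0`. Hence `V` is a Lie algebra, the pairing identifies `C` with `V*`
(`corePairing_bijective`), and invariance of the pairing makes the action on `C` coadjoint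
(`corePairing_bracket`).

That the addition of `𝔸` is a Lie subalgebroid makes the anchor a linear map `a : C → V` of the core
component alone (`exists_coreAnchor`) and kills the brackets of constant core sections
(`bracket_coreSection`). The Leibniz rule then forces the bracket of the action algebroid
(`coreMap_bracket`), and the Poisson bivector is constant. The relation `Π` is therefore given by
four linear equations in `a` (`mem_poissonRelation_iff`): its isotropy makes `a` symmetric, its
involutivity makes `a` equivariant, so `a` is `sharp β` for an invariant symmetric `β`. The same
computations read backwards show that the model satisfies the axioms.

An isomorphism commutes with fibrewise multiplication by zero, so it preserves zero sections, and
the metric determines it on the core. For the same reason a double subbundle is a product `W × K`.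
It is Dirac exactly when `K` annihilates `W` and `W` is a subalgebra, and a Lie subalgebroid exactly
when `sharp β` maps `K` into `W`. -/

namespace LACourant

/-! ### Calculus on finite-dimensional spaces without a chosen norm. -/

section Calculus

/-- The norm on a finite-dimensional real vector space given by linear coordinates. -/
noncomputable abbrev coordNorm (E : Type*) [AddCommGroup E] [Module ℝ E]
    [FiniteDimensional ℝ E] : NormedAddCommGroup E :=
  NormedAddCommGroup.induced E (Fin (Module.finrank ℝ E) → ℝ) (coords E) (coords E).injective

/-- The normed space structure given by linear coordinates. -/
noncomputable abbrev coordNormedSpace (E : Type*) [AddCommGroup E] [Module ℝ E]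
    [FiniteDimensional ℝ E] : @NormedSpace ℝ E _ (coordNorm E).toSeminormedAddCommGroup :=
  letI := coordNorm E
  NormedSpace.induced ℝ E (Fin (Module.finrank ℝ E) → ℝ) (coords E)

section Normed

variable {E F : Type*} [NormedAddCommGroup E] [NormedSpace ℝ E]
  [NormedAddCommGroup F] [NormedSpace ℝ F] [FiniteDimensional ℝ F]

/-- Linear coordinates are a continuous linear equivalence for any norm. The later lemmas install a
coordinate norm locally and pass through this equivalence to use `fderiv`. -/
lemma smooth_iff_contDiff [FiniteDimensional ℝ E] (f : E → F) : Smooth f ↔ ContDiff ℝ ∞ f := by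
  let e := (coords E).toContinuousLinearEquiv
  let e' := (coords F).toContinuousLinearEquiv
  have h : (fun x => coords F (f ((coords E).symm x))) = e' ∘ f ∘ e.symm := rfl
  rw [Smooth, h, e'.comp_contDiff_iff, e.symm.contDiff_comp_iff]

lemma dirDeriv_eq_fderiv {f : E → F} {x : E} (hf : DifferentiableAt ℝ f x) (h : E) :
    dirDeriv f x h = fderiv ℝ f x h := by
  let e' := (coords F).toContinuousLinearEquiv
  have h1 : HasFDerivAt (fun y => coords F (f y)) (e'.toContinuousLinearMap ∘L fderiv ℝ f x) x :=
    e'.toContinuousLinearMap.hasFDerivAt.comp x hf.hasFDerivAt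
  rw [dirDeriv, (h1.hasLineDerivAt h).lineDeriv]
  exact (coords F).symm_apply_apply _

end Normed

variable {E F G H : Type*} [AddCommGroup E] [Module ℝ E] [FiniteDimensional ℝ E]
  [AddCommGroup F] [Module ℝ F] [FiniteDimensional ℝ F]
  [AddCommGroup G] [Module ℝ G] [FiniteDimensional ℝ G]
  [AddCommGroup H] [Module ℝ H] [FiniteDimensional ℝ H]

lemma Smooth.comp {g : F → G} {f : E → F} (hg : Smooth g) (hf : Smooth f) :
    Smooth (fun x => g (f x)) := by
  let := coordNorm E; let := coordNormedSpace E
  let := coordNorm F; let := coordNormedSpace F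
  let := coordNorm G; let := coordNormedSpace G
  rw [smooth_iff_contDiff] at *
  exact hg.comp hf

lemma smooth_const (c : F) : Smooth (fun _ : E => c) := by
  let := coordNorm E; let := coordNormedSpace E
  let := coordNorm F; let := coordNormedSpace F
  rw [smooth_iff_contDiff]
  exact contDiff_const

lemma Smooth.prodMk {f : E → F} {g : E → G} (hf : Smooth f) (hg : Smooth g) :
    Smooth (fun x => (f x, g x)) := by
  let := coordNorm E; let := coordNormedSpace E
  let := coordNorm F; let := coordNormedSpace F
  let := coordNorm G; let := coordNormedSpace G
  rw [smooth_iff_contDiff] at *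
  exact hf.prodMk hg

lemma Smooth.add {f g : E → F} (hf : Smooth f) (hg : Smooth g) :
    Smooth (fun x => f x + g x) :=
  (smooth_of_linear (LinearMap.fst ℝ F F + LinearMap.snd ℝ F F)).comp (hf.prodMk hg)

lemma Smooth.sub {f g : E → F} (hf : Smooth f) (hg : Smooth g) :
    Smooth (fun x => f x - g x) :=
  (smooth_of_linear (LinearMap.fst ℝ F F - LinearMap.snd ℝ F F)).comp (hf.prodMk hg)

lemma Smooth.smul {f : E → ℝ} {g : E → F} (hf : Smooth f) (hg : Smooth g) :
    Smooth (fun x => f x • g x) := by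
  let := coordNorm E; let := coordNormedSpace E
  let := coordNorm F; let := coordNormedSpace F
  rw [smooth_iff_contDiff] at *
  exact hf.smul hg

lemma Smooth.linear_comp (l : F →ₗ[ℝ] G) {f : E → F} (hf : Smooth f) :
    Smooth (fun x => l (f x)) :=
  (smooth_of_linear l).comp hf

lemma Smooth.dirDeriv {f : E → F} {g : E → E} (hf : Smooth f) (hg : Smooth g) :
    Smooth (fun x => dirDeriv f x (g x)) := by
  let := coordNorm E; let := coordNormedSpace E
  let := coordNorm F; let := coordNormedSpace F
  rw [smooth_iff_contDiff] at *
  have h : (fun x => LACourant.dirDeriv f x (g x)) = fun x => fderiv ℝ f x (g x) :=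
    funext fun x => dirDeriv_eq_fderiv (hf.differentiable (by simp) x) _
  rw [h]
  exact (hf.fderiv_right (m := ∞) (by simp)).clm_apply hg

lemma dirDeriv_add_right {f : E → F} (hf : Smooth f) (x h h' : E) :
    dirDeriv f x (h + h') = dirDeriv f x h + dirDeriv f x h' := by
  let := coordNorm E; let := coordNormedSpace E
  let := coordNorm F; let := coordNormedSpace F
  rw [smooth_iff_contDiff] at hf
  have hd := hf.differentiable (by simp) x
  simp only [dirDeriv_eq_fderiv hd, map_add]

lemma dirDeriv_smul_right {f : E → F} (hf : Smooth f) (x : E) (t : ℝ) (h : E) :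
    dirDeriv f x (t • h) = t • dirDeriv f x h := by
  let := coordNorm E; let := coordNormedSpace E
  let := coordNorm F; let := coordNormedSpace F
  rw [smooth_iff_contDiff] at hf
  have hd := hf.differentiable (by simp) x
  simp only [dirDeriv_eq_fderiv hd, map_smul]

lemma dirDeriv_add {f g : E → F} (hf : Smooth f) (hg : Smooth g) (x h : E) :
    dirDeriv (fun y => f y + g y) x h = dirDeriv f x h + dirDeriv g x h := by
  let := coordNorm E; let := coordNormedSpace E
  let := coordNorm F; let := coordNormedSpace F
  rw [smooth_iff_contDiff] at hf hg
  have hf' := hf.differentiable (by simp) x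
  have hg' := hg.differentiable (by simp) x
  rw [dirDeriv_eq_fderiv hf', dirDeriv_eq_fderiv hg', dirDeriv_eq_fderiv (hf'.fun_add hg'),
    fderiv_fun_add hf' hg']
  rfl

lemma dirDeriv_smul {f : E → ℝ} {g : E → F} (hf : Smooth f) (hg : Smooth g) (x h : E) :
    dirDeriv (fun y => f y • g y) x h = f x • dirDeriv g x h + dirDeriv f x h • g x := by
  let := coordNorm E; let := coordNormedSpace E
  let := coordNorm F; let := coordNormedSpace F
  rw [smooth_iff_contDiff] at hf hg
  have hf' := hf.differentiable (by simp) x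
  have hg' := hg.differentiable (by simp) x
  rw [dirDeriv_eq_fderiv hf', dirDeriv_eq_fderiv hg', dirDeriv_eq_fderiv (hf'.fun_smul hg'),
    fderiv_fun_smul hf' hg']
  rfl

lemma dirDeriv_const {E : Type*} [AddCommGroup E] [Module ℝ E] (c : F) (x h : E) : dirDeriv (fun _ : E => c) x h = 0 := by
  simp [dirDeriv, lineDeriv]

lemma dirDeriv_linear_comp (l : F →ₗ[ℝ] G) (m : E →ₗ[ℝ] H) {f : H → F} (hf : Smooth f)
    (x h : E) : dirDeriv (fun y => l (f (m y))) x h = l (dirDeriv f (m x) (m h)) := by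
  let := coordNorm E; let := coordNormedSpace E
  let := coordNorm F; let := coordNormedSpace F
  let := coordNorm G; let := coordNormedSpace G
  let := coordNorm H; let := coordNormedSpace H
  rw [smooth_iff_contDiff] at hf
  have hf' := hf.differentiable (by simp) (m x)
  have h1 : HasFDerivAt (fun y => l (f (m y)))
      (l.toContinuousLinearMap ∘L fderiv ℝ f (m x) ∘L m.toContinuousLinearMap) x :=
    l.toContinuousLinearMap.hasFDerivAt.comp x
      (hf'.hasFDerivAt.comp x m.toContinuousLinearMap.hasFDerivAt)
  rw [dirDeriv_eq_fderiv hf', dirDeriv_eq_fderiv h1.differentiableAt, h1.fderiv]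
  rfl

lemma lineDeriv_eq_dirDeriv {f : E → ℝ} (hf : Smooth f) (x h : E) :
    lineDeriv ℝ f x h = dirDeriv f x h := by
  let := coordNorm E; let := coordNormedSpace E
  rw [smooth_iff_contDiff] at hf
  have hf' := hf.differentiable (by simp) x
  rw [dirDeriv_eq_fderiv hf', hf'.lineDeriv_eq_fderiv]

/-! ### The bracket of an action Lie algebroid by constant vector fields. -/

/-- The bracket of `F`-valued functions, regarded as sections of the action Lie algebroid of the
abelian Lie algebra `F` acting on `E` by the constant vector fields `a c`. -/
noncomputable def actionBracket (a : F →ₗ[ℝ] E) (s t : E → F) (x : E) : F :=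
  dirDeriv t x (a (s x)) - dirDeriv s x (a (t x))

lemma Smooth.actionBracket (a : F →ₗ[ℝ] E) {s t : E → F} (hs : Smooth s) (ht : Smooth t) :
    Smooth (actionBracket a s t) :=
  (ht.dirDeriv (hs.linear_comp a)).sub (hs.dirDeriv (ht.linear_comp a))

omit [FiniteDimensional ℝ E] in
lemma actionBracket_const (a : F →ₗ[ℝ] E) (c c' : F) (x : E) :
    actionBracket a (fun _ => c) (fun _ => c') x = 0 := by
  simp [actionBracket, dirDeriv_const]

lemma actionBracket_add_right (a : F →ₗ[ℝ] E) {s t t' : E → F} (hs : Smooth s) (ht : Smooth t)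
    (ht' : Smooth t') (x : E) : actionBracket a s (fun y => t y + t' y) x =
      actionBracket a s t x + actionBracket a s t' x := by
  simp only [actionBracket, dirDeriv_add ht ht', map_add, dirDeriv_add_right hs]
  abel

lemma actionBracket_smul_right (a : F →ₗ[ℝ] E) {s t : E → F} {f : E → ℝ} (hs : Smooth s)
    (ht : Smooth t) (hf : Smooth f) (x : E) : actionBracket a s (fun y => f y • t y) x =
      dirDeriv f x (a (s x)) • t x + f x • actionBracket a s t x := by
  simp only [actionBracket, dirDeriv_smul hf ht, map_smul, dirDeriv_smul_right hs, smul_sub]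
  abel

/-- A section `s` is encoded as the vector field `(a (s x), s x)` on `E × F`, constant along `F`.
This turns `actionBracket` into the Lie bracket of vector fields, and the `F`-component recovers
`s`, so the identity is inherited from vector fields. -/
lemma actionBracket_jacobi (a : F →ₗ[ℝ] E) {s t r : E → F} (hs : Smooth s) (ht : Smooth t)
    (hr : Smooth r) (x : E) : actionBracket a s (actionBracket a t r) x =
      actionBracket a (actionBracket a s t) r x + actionBracket a t (actionBracket a s r) x := by
  let := coordNorm E; let := coordNormedSpace E
  let := coordNorm F; let := coordNormedSpace F
  let a' : F →L[ℝ] E := a.toContinuousLinearMap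
  let X : (E → F) → E × F → E × F := fun s p => (a' (s p.1), s p.1)
  have hX {s : E → F} (hs : Smooth s) : ContDiff ℝ ∞ (X s) := by
    rw [smooth_iff_contDiff] at hs
    have h1 : ContDiff ℝ ∞ (fun p : E × F => s p.1) := hs.comp contDiff_fst
    exact (a'.contDiff.comp h1).prodMk h1
  have hdX {s : E → F} (hs : Smooth s) (p q : E × F) :
      fderiv ℝ (X s) p q = (a' (fderiv ℝ s p.1 q.1), fderiv ℝ s p.1 q.1) := by
    rw [smooth_iff_contDiff] at hs
    have h1 : HasFDerivAt (fun p : E × F => s p.1)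
        (fderiv ℝ s p.1 ∘L ContinuousLinearMap.fst ℝ E F) p :=
      ((hs.differentiable (by simp) p.1).hasFDerivAt).comp p hasFDerivAt_fst
    have h2 : HasFDerivAt (X s) ((a' ∘L (fderiv ℝ s p.1 ∘L ContinuousLinearMap.fst ℝ E F)).prod
        (fderiv ℝ s p.1 ∘L ContinuousLinearMap.fst ℝ E F)) p :=
      (a'.hasFDerivAt.comp p h1).prodMk h1
    rw [h2.fderiv]
    rfl
  have hbr {s t : E → F} (hs : Smooth s) (ht : Smooth t) :
      VectorField.lieBracket ℝ (X s) (X t) = X (actionBracket a s t) := by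
    have hs' := ((smooth_iff_contDiff s).1 hs).differentiable (by simp)
    have ht' := ((smooth_iff_contDiff t).1 ht).differentiable (by simp)
    funext p
    rw [VectorField.lieBracket, hdX hs, hdX ht]
    simp only [X, actionBracket, dirDeriv_eq_fderiv (hs' _), dirDeriv_eq_fderiv (ht' _), map_sub]
    rfl
  have hJ := VectorField.leibniz_identity_lieBracket (𝕜 := ℝ) (n := ∞)
    (by simpa using (mod_cast le_top : ((2 : ℕ∞) : WithTop ℕ∞) ≤ ∞))
    (hX hs).contDiffAt (hX ht).contDiffAt (hX hr).contDiffAt (x := (x, (0 : F)))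
  rw [hbr ht hr, hbr hs ht, hbr hs hr, hbr hs (ht.actionBracket a hr),
    hbr (hs.actionBracket a ht) hr, hbr ht (hs.actionBracket a hr)] at hJ
  exact congrArg Prod.snd hJ

/-- Smooth functions are sums of products of smooth real functions with constants. -/
lemma smooth_induction {P : (E → F) → Prop}
    (hsmul : ∀ (f : E → ℝ) (c : F), Smooth f → P (fun x => f x • c))
    (hadd : ∀ s t, Smooth s → Smooth t → P s → P t → P (fun x => s x + t x))
    {s : E → F} (hs : Smooth s) : P s := by
  classical
  let b := Module.finBasis ℝ F
  have key (I : Finset (Fin (Module.finrank ℝ F))) :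
      Smooth (fun x => ∑ i ∈ I, b.coord i (s x) • b i) ∧
        P (fun x => ∑ i ∈ I, b.coord i (s x) • b i) := by
    induction I using Finset.induction_on with
    | empty => 
      have h0 := hsmul (fun _ => 0) 0 (smooth_const 0)
      simp only [smul_zero] at h0
      exact ⟨smooth_const 0, h0⟩
    | insert i I hi ih =>
      have h1 : Smooth (fun x => b.coord i (s x)) := hs.linear_comp (b.coord i)
      have h2 := h1.smul (smooth_const (E := E) (b i))
      simp only [Finset.sum_insert hi]
      exact ⟨h2.add ih.1, hadd _ _ h2 ih.1 (hsmul _ _ h1) ih.2⟩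
  have h := (key Finset.univ).2
  simp only [Module.Basis.coord_apply, b.sum_repr] at h
  exact h

/-! ### Coisotropy of linear subspaces. -/

/-- The tangent vectors of a linear subspace. -/
lemma tangentVectors_submodule (N : Submodule ℝ E) {p : E} (hp : p ∈ N) :
    tangentVectors (N : Set E) p = N := by
  ext h
  constructor
  · rintro ⟨γ, hγ, hN, -, rfl⟩
    -- Modulo `N` the curve is constantly zero, hence so is its velocity. Conversely, straight lines
    -- realise every vector of `N`.
    rw [SetLike.mem_coe, ← N.ker_mkQ, LinearMap.mem_ker]
    have h1 := dirDeriv_linear_comp N.mkQ LinearMap.id hγ 0 1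
    simp only [LinearMap.id_apply] at h1
    rw [← h1]
    have h2 : (fun t => N.mkQ (γ t)) = fun _ => 0 := funext fun t => by
      simpa using hN t
    rw [h2, dirDeriv_const]
  · intro hh
    refine ⟨fun t => p + t • h, (smooth_const p).add
      (smooth_of_linear (LinearMap.toSpanSingleton ℝ E h)),
      fun t => N.add_mem hp (N.smul_mem t hh), by simp, ?_⟩
    have h1 := dirDeriv_add (smooth_const p) (smooth_of_linear (LinearMap.toSpanSingleton ℝ E h))
      (0 : ℝ) 1
    simp only [LinearMap.toSpanSingleton_apply] at h1
    rw [h1, dirDeriv_const, zero_add]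
    change dirDeriv (fun t : ℝ => t • h) 0 1 = h
    have h2 := dirDeriv_smul (smooth_of_linear (LinearMap.id (R := ℝ) (M := ℝ)))
      (smooth_const (E := ℝ) h) 0 1
    simp only [LinearMap.id_apply, dirDeriv_const, smul_zero, zero_add] at h2
    rw [h2, ← lineDeriv_eq_dirDeriv (smooth_of_linear (LinearMap.id (R := ℝ) (M := ℝ)))]
    simp [lineDeriv]

lemma isCoisotropic_submodule {Cov : Type*} {ev : Cov → E → ℝ} {π : E → Cov → Cov → ℝ}
    (N : Submodule ℝ E) : IsCoisotropic ev π (N : Set E) ↔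
      ∀ p ∈ N, ∀ α α' : Cov, (∀ h ∈ N, ev α h = 0) → (∀ h ∈ N, ev α' h = 0) → π p α α' = 0 := by
  refine forall₂_congr fun p hp => ?_
  simp only [tangentVectors_submodule N hp, SetLike.mem_coe]

end Calculus

/-! ### The canonical splitting of a double vector bundle over a point. -/

namespace DoubleVB

variable {V : Type*} {𝔸 : Type*} [AddCommGroup V] [Module ℝ V] [FiniteDimensional ℝ V]
  [AddCommGroup 𝔸] [Module ℝ 𝔸] [FiniteDimensional ℝ 𝔸] (D : DoubleVB V 𝔸)

/-- Interchange produces elements of fibres such as the one over `v + 0`, a different type from the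
fibre over `v`; this lemma and the next transport the operations. -/
lemma coe_add_cast {v w : V} (h : v = w) (x y : D.Fibre v) :
    ((x + y : D.Fibre v) : 𝔸) =
      ((⟨x, x.2.trans h⟩ + ⟨y, y.2.trans h⟩ : D.Fibre w) : 𝔸) := by
  subst h; rfl

lemma coe_smul_cast {v w : V} (h : v = w) (t : ℝ) (x : D.Fibre v) :
    ((t • x : D.Fibre v) : 𝔸) = ((t • ⟨x, x.2.trans h⟩ : D.Fibre w) : 𝔸) := by
  subst h; rfl

/-- The zero section of `𝔸 → V`, which is linear. -/
def zeroSection : V →ₗ[ℝ] 𝔸 where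
  toFun v := (0 : D.Fibre v)
  map_add' v v' := by
    -- Interchange shows that `0_v + 0_v'` equals its own double in the fibre over `v + v'`, so it
    -- is the zero there. Homogeneity is proved in the same way.
    have h := D.add_interchange v v' 0 0 0 0
    simp only [add_zero] at h
    let w : D.Fibre (v + v') :=
      ⟨(0 : D.Fibre v) + (0 : D.Fibre v'), by rw [map_add, (0 : D.Fibre v).2, (0 : D.Fibre v').2]⟩
    have h' : w = w + w := Subtype.ext h
    exact (congrArg Subtype.val (left_eq_add.1 h')).symm
  map_smul' t v := by
    have h := D.smul_interchange t v 0 0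
    simp only [add_zero] at h
    let w : D.Fibre (t • v) := ⟨t • ((0 : D.Fibre v) : 𝔸), by rw [map_smul, (0 : D.Fibre v).2]⟩
    have h' : w = w + w := Subtype.ext h
    exact (congrArg Subtype.val (left_eq_add.1 h')).symm

lemma coe_zero (v : V) : ((0 : D.Fibre v) : 𝔸) = D.zeroSection v := rfl

@[simp] lemma proj_zeroSection (v : V) : D.proj (D.zeroSection v) = v := (0 : D.Fibre v).2

/-- Interchange is applied to `x` plus `0_v` over `v` and to `0` plus `y - 0_v` over `0`. -/
lemma coe_add {v : V} (x y : D.Fibre v) :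
    ((x + y : D.Fibre v) : 𝔸) = x + y - D.zeroSection v := by
  have h := D.add_interchange v 0 x 0 0 ⟨y - D.zeroSection v, by simp [y.2]⟩
  rw [D.coe_add_cast (add_zero v)] at h
  simp only [add_zero, zero_add, D.coe_zero, map_zero, add_sub_cancel] at h
  rw [add_sub_assoc, h]

/-- The two additions on the core agree, so the inverse of a fibre chart is additive into `𝔸`. Local
triviality makes it continuous, and continuous additive maps are real-linear. This is where
smoothness of the bundle matters. -/
lemma coe_smul_zero (t : ℝ) (c : D.Fibre 0) : ((t • c : D.Fibre 0) : 𝔸) = t • (c : 𝔸) := by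
  obtain ⟨U, n, φ, -, h0, -, hφ⟩ := D.locally_trivial 0
  let ψ : (Fin n → ℝ) →+ (Fin (Module.finrank ℝ 𝔸) → ℝ) :=
    { toFun w := coords 𝔸 ((φ 0).symm w)
      map_zero' := by rw [map_zero, D.coe_zero, map_zero, map_zero]
      map_add' w w' := by rw [map_add, D.coe_add, map_zero, sub_zero, map_add] }
  have hψ : Continuous ψ := by
    let ι : (Fin n → ℝ) →ₗ[ℝ] _ :=
      (coords (V × (Fin n → ℝ))).toLinearMap ∘ₗ LinearMap.inr ℝ V (Fin n → ℝ)
    have h1 := hφ.continuousOn.comp_continuous (f := ι) ι.continuous_of_finiteDimensional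
      (fun w => by simpa [ι] using h0)
    exact h1.congr fun w => congrArg
      (fun p : V × (Fin n → ℝ) => coords 𝔸 ((φ p.1).symm p.2 : 𝔸))
      ((coords (V × (Fin n → ℝ))).symm_apply_apply (0, w))
  have h2 := map_real_smul ψ hψ t (φ 0 c)
  have h3 : coords 𝔸 ((φ 0).symm (t • φ 0 c)) = t • coords 𝔸 ((φ 0).symm (φ 0 c)) := h2
  rw [map_smul, LinearEquiv.symm_apply_apply, ← map_smul] at h3
  exact (coords 𝔸).injective h3

lemma coe_smul {v : V} (t : ℝ) (x : D.Fibre v) :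
    ((t • x : D.Fibre v) : 𝔸) = D.zeroSection v + t • ((x : 𝔸) - D.zeroSection v) := by
  have h := D.fibre_smul_interchange t v 0 0 ⟨x - D.zeroSection v, by simp [x.2]⟩
  rw [D.coe_smul_cast (add_zero v)] at h
  simp only [smul_zero, D.coe_zero, add_sub_cancel] at h
  rw [h, D.coe_smul_zero]

lemma coe_corePart (d : 𝔸) : (D.corePart d : 𝔸) = d - D.zeroSection (D.proj d) := rfl

lemma coe_coreSection (c : D.Core) (v : V) : (D.coreSection c v : 𝔸) = D.zeroSection v + c := rfl

lemma zeroSection_add_corePart (d : 𝔸) : D.zeroSection (D.proj d) + D.corePart d = d := by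
  rw [coe_corePart, add_sub_cancel]

@[simp] lemma proj_core (c : D.Core) : D.proj c = 0 := LinearMap.mem_ker.1 c.2

/-- The core component, as a linear map. -/
def coreMap : 𝔸 →ₗ[ℝ] D.Core where
  toFun := D.corePart
  map_add' d e := Subtype.ext (by simp only [coe_corePart, map_add, Submodule.coe_add]; abel)
  map_smul' t d := Subtype.ext (by
    simp only [coe_corePart, map_smul, Submodule.coe_smul, smul_sub, RingHom.id_apply])

lemma corePart_eq_coreMap (d : 𝔸) : D.corePart d = D.coreMap d := rfl

@[simp] lemma coreMap_core (c : D.Core) : D.coreMap c = c :=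
  Subtype.ext (by rw [← corePart_eq_coreMap, coe_corePart, proj_core, map_zero, sub_zero])

@[simp] lemma coreMap_zeroSection (v : V) : D.coreMap (D.zeroSection v) = 0 :=
  Subtype.ext (by
    rw [← corePart_eq_coreMap, coe_corePart, proj_zeroSection, sub_self, Submodule.coe_zero])

@[simp] lemma coreMap_coreSection (c : D.Core) (v : V) :
    D.coreMap (D.coreSection c v : 𝔸) = c := by
  rw [coe_coreSection, map_add, coreMap_core, coreMap_zeroSection, zero_add]

@[simp] lemma coreMap_coe_add {v : V} (x y : D.Fibre v) :
    D.coreMap (x + y : D.Fibre v) = D.coreMap x + D.coreMap y := by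
  rw [coe_add, map_sub, map_add, coreMap_zeroSection, sub_zero]

@[simp] lemma coreMap_coe_smul {v : V} (t : ℝ) (x : D.Fibre v) :
    D.coreMap (t • x : D.Fibre v) = t • D.coreMap x := by
  rw [coe_smul, map_add, map_smul, map_sub, coreMap_zeroSection, sub_zero, zero_add]

@[simp] lemma coreMap_coe_neg {v : V} (x : D.Fibre v) :
    D.coreMap (-x : D.Fibre v) = -D.coreMap x := by
  rw [← neg_one_smul ℝ x, coreMap_coe_smul, neg_one_smul]

variable {D} in
lemma ext_proj_coreMap {d e : 𝔸} (h : D.proj d = D.proj e) (h' : D.coreMap d = D.coreMap e) :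
    d = e := by
  rw [← D.zeroSection_add_corePart d, ← D.zeroSection_add_corePart e, h, corePart_eq_coreMap, h']
  rfl

variable {D} in
lemma fibre_ext {v : V} {x y : D.Fibre v} (h : D.coreMap x = D.coreMap y) : x = y :=
  Subtype.ext (ext_proj_coreMap (x.2.trans y.2.symm) h)

lemma mem_graphFibreAdd {z : 𝔸 × (𝔸 × 𝔸)} : z ∈ D.graphFibreAdd ↔
    D.proj z.2.1 = D.proj z.1 ∧ D.proj z.2.2 = D.proj z.1 ∧
      D.coreMap z.1 = D.coreMap z.2.1 + D.coreMap z.2.2 := by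
  constructor
  · rintro ⟨v, x, y, rfl⟩
    exact ⟨x.2.trans (x + y).2.symm, y.2.trans (x + y).2.symm, D.coreMap_coe_add x y⟩
  · rintro ⟨h1, h2, h3⟩
    obtain ⟨d, x, y⟩ := z
    refine ⟨D.proj d, ⟨x, h1⟩, ⟨y, h2⟩, Prod.ext (ext_proj_coreMap (D := D) ?_ ?_) rfl⟩
    · exact (⟨x, h1⟩ + ⟨y, h2⟩ : D.Fibre (D.proj d)).2.symm
    · exact h3.trans (D.coreMap_coe_add ⟨x, h1⟩ ⟨y, h2⟩).symm

lemma isSmoothSection_iff {σ : ∀ v, D.Fibre v} :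
    D.IsSmoothSection σ ↔ Smooth (fun v => D.coreMap (σ v)) := by
  constructor
  · exact fun h => Smooth.linear_comp (f := fun v => (σ v : 𝔸)) D.coreMap h
  · intro h
    have h0 : Smooth (fun v => ((D.coreMap (σ v) : D.Core) : 𝔸)) := h.linear_comp D.Core.subtype
    have h1 := (smooth_of_linear D.zeroSection).add h0
    refine (congrArg Smooth (funext fun v => ?_)).mp h1
    have h2 := D.zeroSection_add_corePart (σ v)
    rwa [(σ v).2] at h2

/-- The section of `𝔸 → V` with a given core component. -/
def sectionOfCore (s : V → D.Core) (v : V) : D.Fibre v := D.coreSection (s v) v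

@[simp] lemma coreMap_sectionOfCore (s : V → D.Core) (v : V) :
    D.coreMap (D.sectionOfCore s v : 𝔸) = s v :=
  D.coreMap_coreSection (s v) v

lemma isSmoothSection_sectionOfCore {s : V → D.Core} (hs : Smooth s) :
    D.IsSmoothSection (D.sectionOfCore s) := by
  simpa only [isSmoothSection_iff, coreMap_sectionOfCore] using hs

lemma sectionOfCore_coreMap (σ : ∀ v, D.Fibre v) :
    D.sectionOfCore (fun v => D.coreMap (σ v)) = σ :=
  funext fun v => fibre_ext (D.coreMap_sectionOfCore _ v)

lemma sectionOfCore_const (c : D.Core) : D.sectionOfCore (fun _ => c) = D.coreSection c := rfl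

/-- The annihilator of the graph of the addition of the vector space `𝔸` is linear. -/
def annihilatorGraphAddSubmodule :
    Submodule ℝ (D.DualBundle × D.DualBundle × D.DualBundle) where
  carrier := {p | p.1.1 = p.2.1.1 + p.2.2.1 ∧ p.2.1.2 = -p.1.2 ∧ p.2.2.2 = -p.1.2}
  zero_mem' := by simp
  add_mem' := by
    rintro p q ⟨h1, h2, h3⟩ ⟨h1', h2', h3'⟩
    refine ⟨?_, ?_, ?_⟩
    · simp only [Prod.fst_add, Prod.snd_add, h1, h1']; abel
    · simp only [Prod.fst_add, Prod.snd_add, h2, h2']; abel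
    · simp only [Prod.snd_add, Prod.fst_add, h3, h3']; abel
  smul_mem' := by
    rintro t p ⟨h1, h2, h3⟩
    refine ⟨?_, ?_, ?_⟩
    · simp only [Prod.smul_fst, Prod.smul_snd, h1, smul_add]
    · simp only [Prod.smul_fst, Prod.smul_snd, h2, smul_neg]
    · simp only [Prod.smul_fst, Prod.smul_snd, h3, smul_neg]

lemma mem_annihilatorGraphAddSubmodule {p : D.DualBundle × D.DualBundle × D.DualBundle} :
    p ∈ D.annihilatorGraphAddSubmodule ↔
      p.1.1 = p.2.1.1 + p.2.2.1 ∧ p.2.1.2 = -p.1.2 ∧ p.2.2.2 = -p.1.2 := Iff.rfl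

lemma coe_annihilatorGraphAddSubmodule :
    (D.annihilatorGraphAddSubmodule : Set (D.DualBundle × D.DualBundle × D.DualBundle)) =
      D.annihilatorGraphAdd := by
  ext ⟨⟨v, ξ⟩, ⟨v₁, ξ₁⟩, ⟨v₂, ξ₂⟩⟩
  rw [SetLike.mem_coe, mem_annihilatorGraphAddSubmodule]
  simp only [annihilatorGraphAdd, Set.mem_ofPred_eq, corePart_eq_coreMap, map_add]
  refine and_congr_right fun _ => ⟨?_, ?_⟩
  · rintro ⟨rfl, rfl⟩ d d' - -
    simp only [LinearMap.neg_apply]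
    ring
  -- Testing on a core vector in one summand and a zero vector in the other isolates each covector.
  · intro h
    constructor <;> ext c
    · have h1 := h (D.coreSection c v₁) (D.zeroSection v₂) (D.coreSection c v₁).2 (by simp)
      simp only [coreMap_coreSection, coreMap_zeroSection, map_zero] at h1
      rw [LinearMap.neg_apply]; linarith
    · have h1 := h (D.zeroSection v₁) (D.coreSection c v₂) (by simp) (D.coreSection c v₂).2
      simp only [coreMap_coreSection, coreMap_zeroSection, map_zero] at h1
      rw [LinearMap.neg_apply]; linarith

end DoubleVB

/-! ### The linear Poisson structure and the relation `Π`. -/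

namespace Data

variable {V : Type*} {𝔸 : Type*} [AddCommGroup V] [Module ℝ V] [FiniteDimensional ℝ V]
  [AddCommGroup 𝔸] [Module ℝ 𝔸] [FiniteDimensional ℝ 𝔸] (A : Data V 𝔸)

/-- The annihilator of the graph is linear, so its tangent space is itself at every point. Its
conormal space consists of the triples `((α, c₁ + c₂), (-α, c₁), (-α, c₂))`, and coisotropy is the
vanishing of the bivector on them. -/
lemma graph_add_isCoisotropic_iff :
    IsCoisotropic
      (fun (p : A.DualCovector × A.DualCovector × A.DualCovector) h =>
        A.covEval p.1 h.1 + A.covEval p.2.1 h.2.1 + A.covEval p.2.2 h.2.2)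
      (fun q p p' => A.poisson q.1 p.1 p'.1 + A.poisson q.2.1 p.2.1 p'.2.1
        + A.poisson q.2.2 p.2.2 p'.2.2)
      A.annihilatorGraphAdd ↔
    ∀ (v₁ v₂ : V) (ξ : Module.Dual ℝ A.Core) (α α' : Module.Dual ℝ V) (c₁ c₂ c₁' c₂' : A.Core),
      A.poisson (v₁ + v₂, ξ) (α, c₁ + c₂) (α', c₁' + c₂')
        + A.poisson (v₁, -ξ) (-α, c₁) (-α', c₁') + A.poisson (v₂, -ξ) (-α, c₂) (-α', c₂') = 0 := by
  rw [← A.coe_annihilatorGraphAddSubmodule, isCoisotropic_submodule]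
  simp only [A.mem_annihilatorGraphAddSubmodule]
  constructor
  · intro h v₁ v₂ ξ α α' c₁ c₂ c₁' c₂'
    refine h ((v₁ + v₂, ξ), (v₁, -ξ), (v₂, -ξ)) ⟨rfl, rfl, rfl⟩
      ((α, c₁ + c₂), (-α, c₁), (-α, c₂)) ((α', c₁' + c₂'), (-α', c₁'), (-α', c₂')) ?_ ?_
    all_goals
      rintro ⟨⟨w, η⟩, ⟨w₁, η₁⟩, ⟨w₂, η₂⟩⟩ ⟨h1, h2, h3⟩
      simp only at h1 h2 h3
      simp only [DoubleVB.covEval, h1, h2, h3, map_add, LinearMap.neg_apply]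
      ring
  · intro h
    -- Conormal triples have this shape: test on tangent vectors along the fibres, then on two
    -- families along the base.
    have key : ∀ p : A.DualCovector × A.DualCovector × A.DualCovector,
        (∀ h : A.DualBundle × A.DualBundle × A.DualBundle,
          h.1.1 = h.2.1.1 + h.2.2.1 ∧ h.2.1.2 = -h.1.2 ∧ h.2.2.2 = -h.1.2 →
          A.covEval p.1 h.1 + A.covEval p.2.1 h.2.1 + A.covEval p.2.2 h.2.2 = 0) →
        p = ((p.1.1, p.2.1.2 + p.2.2.2), (-p.1.1, p.2.1.2), (-p.1.1, p.2.2.2)) := by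
      rintro ⟨⟨α, c⟩, ⟨α₁, c₁⟩, ⟨α₂, c₂⟩⟩ hp
      have h1 : c = c₁ + c₂ := by
        rw [← sub_eq_zero, ← Module.forall_dual_apply_eq_zero_iff ℝ]
        intro η
        have := hp ((0, η), (0, -η), (0, -η)) (by simp)
        simp only [DoubleVB.covEval, map_zero, LinearMap.neg_apply] at this
        rw [map_sub, map_add]; linarith
      have h2 : α₁ = -α := by
        ext w
        have := hp ((w, 0), (w, 0), (0, 0)) (by simp)
        simp only [DoubleVB.covEval, map_zero, LinearMap.zero_apply] at this
        rw [LinearMap.neg_apply]; linarith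
      have h3 : α₂ = -α := by
        ext w
        have := hp ((w, 0), (0, 0), (w, 0)) (by simp)
        simp only [DoubleVB.covEval, map_zero, LinearMap.zero_apply] at this
        rw [LinearMap.neg_apply]; linarith
      rw [h1, h2, h3]
    rintro ⟨⟨v, ξ⟩, ⟨v₁, ξ₁⟩, ⟨v₂, ξ₂⟩⟩ ⟨h1, h2, h3⟩ p p' hp hp'
    simp only at h1 h2 h3
    rw [key p hp, key p' hp', h1, h2, h3]
    exact h _ _ _ _ _ _ _ _ _

section ConstantAnchor

variable {A} {a : A.Core →ₗ[ℝ] V} (ha : ∀ d, A.anchor d = a (A.coreMap d))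
  (hb : ∀ (c c' : A.Core) (v : V),
    A.coreMap (A.bracket (A.coreSection c) (A.coreSection c') v : 𝔸) = 0)
include ha hb

lemma poisson_eq (q : A.DualBundle) (p p' : A.DualCovector) :
    A.poisson q p p' = p'.1 (a p.2) - p.1 (a p'.2) := by
  simp only [poisson, ha, A.corePart_eq_coreMap, hb, A.coreMap_coreSection, map_zero, zero_add]

lemma mem_graphSharp_iff {z : (A.DualBundle × A.DualBundle) × (A.DualBundle × A.DualCovector)} :
    z ∈ A.graphSharp ↔ z.1.1 = z.2.1 ∧ z.1.2 = (a z.2.2.2, -(z.2.2.1 ∘ₗ a)) := by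
  obtain ⟨⟨q', h, η⟩, q, α, c⟩ := z
  simp only [graphSharp, Set.mem_ofPred_eq, poisson_eq ha hb, DoubleVB.covEval]
  refine and_congr_right fun _ => ⟨fun H => ?_, fun H p' => ?_⟩
  · refine Prod.ext ?_ ?_
    · rw [← sub_eq_zero, ← Module.forall_dual_apply_eq_zero_iff ℝ]
      intro α'
      have := H (α', 0)
      simp only [map_zero] at this
      rw [map_sub]; linarith
    · ext e
      have := H (0, e)
      simp only [LinearMap.zero_apply] at this
      rw [LinearMap.neg_apply, LinearMap.comp_apply]; linarith
  · simp only [Prod.mk.injEq] at H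
    rw [H.1, H.2, LinearMap.neg_apply, LinearMap.comp_apply, sub_eq_add_neg]

/-- The first two equations say that `w` lies over the base of the graph. The graph elements over it
form a family with free parameters `ξ` and `α`; comparing the coefficients of each in the equality
of pairings gives the other two equations. -/
lemma mem_poissonRelation_iff {w : (𝔸 × 𝔸) × (𝔸 × 𝔸)} :
    w ∈ A.poissonRelation ↔ A.proj w.1.1 = A.proj w.2.1 ∧ A.proj w.1.2 = a (A.coreMap w.2.1) ∧
      A.proj w.2.2 = a (A.coreMap w.1.1) ∧ A.coreMap w.1.2 = A.coreMap w.2.2 := by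
  obtain ⟨⟨y, y'⟩, ⟨x, x'⟩⟩ := w
  have hcomp (z : (A.DualBundle × A.DualBundle) × (A.DualBundle × A.DualCovector)) :
      z ∈ A.graphSharp ∧ A.Composable (y, y') (x, x') z ↔
        (A.proj y = A.proj x ∧ A.proj y' = a (A.coreMap x)) ∧ ∃ ξ α,
          z = (((A.proj x, ξ), (a (A.coreMap x), -(α ∘ₗ a))), ((A.proj x, ξ), (α, A.coreMap x))) := by
    rw [mem_graphSharp_iff ha hb]
    constructor
    · obtain ⟨⟨q', h⟩, ⟨v, ξ⟩, α, c⟩ := z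
      rintro ⟨⟨h4, h5⟩, ⟨⟨h1, h2⟩, h3⟩⟩
      simp only at h1 h2 h3 h4 h5
      subst h4 h5
      simp only at h1 h2
      subst h3
      simp only [A.coreMap_coreSection, (A.coreSection c v).2]
      exact ⟨⟨h1.symm, h2.symm⟩, ξ, α, rfl⟩
    · rintro ⟨⟨h1, h2⟩, ξ, α, rfl⟩
      exact ⟨⟨rfl, rfl⟩, ⟨h1.symm, h2.symm⟩, A.zeroSection_add_corePart x⟩
  have hmem : ((y, y'), (x, x')) ∈ A.poissonRelation ↔
      (A.proj y = A.proj x ∧ A.proj y' = a (A.coreMap x)) ∧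
      ∀ (ξ : Module.Dual ℝ A.Core) (α : Module.Dual ℝ V),
        ξ (A.coreMap y') - α (a (A.coreMap y)) = ξ (A.coreMap x') - α (A.proj x') := by
    simp only [poissonRelation, Set.mem_ofPred_eq, hcomp, ← and_imp]
    constructor
    · rintro ⟨⟨z, h, -⟩, H⟩
      refine ⟨h, fun ξ α => ?_⟩
      have := H _ ⟨h, ξ, α, rfl⟩
      simp only [DoubleVB.tangentPairing, DoubleVB.cotangentPairing, DoubleVB.covEval,
        A.corePart_eq_coreMap, LinearMap.neg_apply, LinearMap.comp_apply,
        LinearMap.zero_apply] at this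
      linarith
    · rintro ⟨h, H⟩
      refine ⟨⟨_, h, 0, 0, rfl⟩, ?_⟩
      rintro z ⟨-, ξ, α, rfl⟩
      have := H ξ α
      simp only [DoubleVB.tangentPairing, DoubleVB.cotangentPairing, DoubleVB.covEval,
        A.corePart_eq_coreMap, LinearMap.neg_apply, LinearMap.comp_apply,
        LinearMap.zero_apply]
      linarith
  rw [hmem, and_assoc]
  refine and_congr_right fun _ => and_congr_right fun _ => ⟨fun H => ⟨?_, ?_⟩, ?_⟩
  · rw [← sub_eq_zero, ← Module.forall_dual_apply_eq_zero_iff ℝ]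
    intro α
    have := H 0 α
    simp only [LinearMap.zero_apply] at this
    rw [map_sub]; linarith
  · rw [← sub_eq_zero, ← Module.forall_dual_apply_eq_zero_iff ℝ]
    intro ξ
    have := H ξ 0
    simp only [LinearMap.zero_apply] at this
    rw [map_sub]; linarith
  · rintro ⟨h1, h2⟩ ξ α
    rw [h1, h2]

end ConstantAnchor

end Data

/-! ### The model is an LA-Courant algebroid. -/

section Model

variable {𝔤 : Type*} [LieRing 𝔤] [LieAlgebra ℝ 𝔤] [FiniteDimensional ℝ 𝔤]
  {β : LinearMap.BilinForm ℝ (Module.Dual ℝ 𝔤)}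

lemma apply_sharp (β : LinearMap.BilinForm ℝ (Module.Dual ℝ 𝔤)) (μ ν : Module.Dual ℝ 𝔤) :
    ν (sharp β μ) = β μ ν :=
  Module.apply_evalEquiv_symm_apply ℝ 𝔤 ν (β μ)

lemma dual_ext {E : Type*} [AddCommGroup E] [Module ℝ E] [FiniteDimensional ℝ E] {x y : E}
    (h : ∀ f : Module.Dual ℝ E, f x = f y) : x = y := by
  rw [← sub_eq_zero, ← Module.forall_dual_apply_eq_zero_iff ℝ]
  intro f
  rw [map_sub, h f, sub_self]

lemma sharp_lie (hβ : β.lieInvariant 𝔤) (x : 𝔤) (μ : Module.Dual ℝ 𝔤) :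
    sharp β ⁅x, μ⁆ = ⁅x, sharp β μ⁆ := by
  refine dual_ext fun ν => ?_
  rw [apply_sharp, hβ x μ ν, ← apply_sharp, Module.Dual.lie_apply, neg_neg]

/-- At `x` the left side is `β ⁅x, μ⁆ ν`, which is antisymmetric in `μ` and `ν` by invariance and
symmetry. -/
lemma sharp_lie_swap (hs : β.IsSymm) (hβ : β.lieInvariant 𝔤) (μ ν : Module.Dual ℝ 𝔤) :
    ⁅sharp β μ, ν⁆ = -⁅sharp β ν, μ⁆ := by
  ext x
  rw [LinearMap.neg_apply, Module.Dual.lie_apply, Module.Dual.lie_apply, ← lie_skew,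
    ← lie_skew _ x, map_neg, map_neg, ← sharp_lie hβ, ← sharp_lie hβ, apply_sharp, apply_sharp,
    hβ x μ ν, ← hs.eq]

lemma semidirect_isCourantAlgebroid : (semidirect 𝔤).IsCourantAlgebroid where
  metric_symm x y := by simp [semidirect, add_comm]
  metric_nondegenerate x h := by
    simp only [semidirect, LinearMap.mk₂_apply] at h
    refine Prod.ext (dual_ext fun f => ?_) ?_
    · simpa using h (0, f)
    · ext y
      simpa using h (y, 0)
  jacobi x y z := by
    simp only [semidirect, LinearMap.mk₂_apply]
    refine Prod.ext (by simp) ?_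
    simp only [lie_sub, lie_lie, Prod.snd_add]
    abel
  metric_invariant x y z := by
    simp only [semidirect, LinearMap.mk₂_apply, LinearMap.sub_apply, Module.Dual.lie_apply]
    rw [← lie_skew z.1 y.1, map_neg]
    ring
  bracket_add_swap x y := by
    simp only [semidirect, LinearMap.mk₂_apply]
    refine Prod.ext ?_ ?_
    · simp only [Prod.fst_add, Prod.fst_zero]
      rw [← lie_skew]; abel
    · simp only [Prod.snd_add, Prod.snd_zero]; abel

lemma model_coe_coreMap (d : 𝔤 × Module.Dual ℝ 𝔤) :
    ((model 𝔤 β).coreMap d : 𝔤 × Module.Dual ℝ 𝔤) = (0, d.2) := by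
  change d - (d.1, 0) = _
  ext <;> simp

lemma model_coreMap_eq_iff {d e : 𝔤 × Module.Dual ℝ 𝔤} :
    (model 𝔤 β).coreMap d = (model 𝔤 β).coreMap e ↔ d.2 = e.2 := by
  rw [← Subtype.coe_inj, model_coe_coreMap, model_coe_coreMap, Prod.mk.injEq]
  simp

lemma model_fibre_ext {v : 𝔤} {x y : (model 𝔤 β).Fibre v} (h : x.1.2 = y.1.2) : x = y :=
  Subtype.ext (Prod.ext (x.2.trans y.2.symm) h)

lemma model_isSmoothSection_iff {σ : ∀ v, (model 𝔤 β).Fibre v} :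
    (model 𝔤 β).IsSmoothSection σ ↔ Smooth (fun v => (σ v).1.2) := by
  constructor
  · exact fun h => Smooth.linear_comp (f := fun v => (σ v).1)
      (LinearMap.snd ℝ 𝔤 (Module.Dual ℝ 𝔤)) h
  · intro h
    refine (congrArg Smooth (funext fun v => ?_)).mp ((smooth_of_linear LinearMap.id).prodMk h)
    exact Prod.ext (σ v).2.symm rfl

lemma model_bracket (σ τ : ∀ v, (model 𝔤 β).Fibre v) (v : 𝔤) :
    ((model 𝔤 β).bracket σ τ v).1.2 =
      actionBracket (sharp β) (fun v => (σ v).1.2) (fun v => (τ v).1.2) v := rfl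

/-- The anchor of the model, as a map on the core. -/
noncomputable def coreSharp (β : LinearMap.BilinForm ℝ (Module.Dual ℝ 𝔤)) :
    (model 𝔤 β).Core →ₗ[ℝ] 𝔤 :=
  sharp β ∘ₗ LinearMap.snd ℝ 𝔤 (Module.Dual ℝ 𝔤) ∘ₗ (model 𝔤 β).Core.subtype

lemma coreSharp_coreMap (d : 𝔤 × Module.Dual ℝ 𝔤) :
    coreSharp β ((model 𝔤 β).coreMap d) = sharp β d.2 := by
  change sharp β ((model 𝔤 β).coreMap d : 𝔤 × Module.Dual ℝ 𝔤).2 = _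
  rw [model_coe_coreMap]

lemma model_bracket_coreSection (c c' : (model 𝔤 β).Core) (v : 𝔤) :
    (model 𝔤 β).coreMap ((model 𝔤 β).bracket ((model 𝔤 β).coreSection c)
      ((model 𝔤 β).coreSection c') v : 𝔤 × Module.Dual ℝ 𝔤) = 0 := by
  have h (c : (model 𝔤 β).Core) (v : 𝔤) : ((model 𝔤 β).coreSection c v).1.2 = c.1.2 :=
    zero_add _
  rw [← map_zero (model 𝔤 β).coreMap, model_coreMap_eq_iff, model_bracket]
  simp only [h, actionBracket_const, Prod.snd_zero]

lemma model_mem_graphFibreAdd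
    {z : (𝔤 × Module.Dual ℝ 𝔤) × (𝔤 × Module.Dual ℝ 𝔤) × (𝔤 × Module.Dual ℝ 𝔤)} :
    z ∈ (model 𝔤 β).graphFibreAdd ↔
      z.2.1.1 = z.1.1 ∧ z.2.2.1 = z.1.1 ∧ z.1.2 = z.2.1.2 + z.2.2.2 := by
  rw [DoubleVB.mem_graphFibreAdd, ← map_add, model_coreMap_eq_iff]
  rfl

lemma model_mem_poissonRelation
    {w : ((𝔤 × Module.Dual ℝ 𝔤) × (𝔤 × Module.Dual ℝ 𝔤)) ×
      ((𝔤 × Module.Dual ℝ 𝔤) × (𝔤 × Module.Dual ℝ 𝔤))} :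
    w ∈ (model 𝔤 β).poissonRelation ↔ w.1.1.1 = w.2.1.1 ∧ w.1.2.1 = sharp β w.2.1.2 ∧
      w.2.2.1 = sharp β w.1.1.2 ∧ w.1.2.2 = w.2.2.2 := by
  rw [Data.mem_poissonRelation_iff (a := coreSharp β) (fun d => (coreSharp_coreMap d).symm)
    model_bracket_coreSection, coreSharp_coreMap, coreSharp_coreMap, model_coreMap_eq_iff]
  rfl

lemma model_graphFibreAdd_isDirac :
    ((semidirect 𝔤).prod (semidirect 𝔤)).IsCourantRelation (semidirect 𝔤)
      (model 𝔤 β).graphFibreAdd where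
  lagrangian := by
    rintro ⟨⟨v, c⟩, ⟨v₁, c₁⟩, ⟨v₂, c₂⟩⟩
    simp only [model_mem_graphFibreAdd, MetricBracket.prod, MetricBracket.bar, semidirect,
      LinearMap.mk₂_apply, LinearMap.neg_apply]
    constructor
    · rintro ⟨rfl, rfl, rfl⟩ ⟨⟨v', c'⟩, ⟨v₁', c₁'⟩, ⟨v₂', c₂'⟩⟩ ⟨h1, h2, h3⟩
      simp only at h1 h2 h3
      subst h1 h2 h3
      simp only [LinearMap.add_apply]
      ring
    · intro h
      -- Each defining equation is recovered from orthogonality to one family of graph elements,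
      -- which replaces a dimension count.
      refine ⟨dual_ext fun f => ?_, dual_ext fun f => ?_, ?_⟩
      · have := h ((0, f), (0, f), (0, 0)) (by simp)
        simp only [map_zero, LinearMap.zero_apply] at this
        linarith
      · have := h ((0, f), (0, 0), (0, f)) (by simp)
        simp only [map_zero, LinearMap.zero_apply] at this
        linarith
      · ext x
        have := h ((x, 0), (x, 0), (x, 0)) (by simp)
        simp only [LinearMap.zero_apply] at this
        rw [LinearMap.add_apply]
        linarith
  involutive := by
    rintro ⟨⟨v, c⟩, ⟨v₁, c₁⟩, ⟨v₂, c₂⟩⟩ h ⟨⟨v', c'⟩, ⟨v₁', c₁'⟩, ⟨v₂', c₂'⟩⟩ h'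
    rw [model_mem_graphFibreAdd] at h h'
    obtain ⟨h1, h2, h3⟩ := h
    obtain ⟨h1', h2', h3'⟩ := h'
    simp only at h1 h2 h3 h1' h2' h3'
    subst h1 h2 h3 h1' h2' h3'
    simp only [model_mem_graphFibreAdd, MetricBracket.prod, MetricBracket.bar, semidirect,
      LinearMap.mk₂_apply, lie_add, true_and]
    abel

/-- Isotropy comes from the symmetry of `β`. For involutivity, equivariance of `sharp β` preserves
the two equations containing it, and `sharp_lie_swap` preserves the equality of the core components
of the velocities. -/
lemma model_poissonRelation_isDirac (hs : β.IsSymm) (hβ : β.lieInvariant 𝔤) :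
    (semidirect 𝔤).tangent.IsCourantRelation (semidirect 𝔤).tangent
      (model 𝔤 β).poissonRelation where
  lagrangian := by
    rintro ⟨⟨⟨v, e⟩, ⟨p, f⟩⟩, ⟨⟨v₁, c⟩, ⟨p₁, f₁⟩⟩⟩
    simp only [model_mem_poissonRelation, MetricBracket.prod, MetricBracket.bar,
      MetricBracket.tangent, semidirect, LinearMap.mk₂_apply, LinearMap.neg_apply]
    have hs' (μ ν : Module.Dual ℝ 𝔤) : ν (sharp β μ) = μ (sharp β ν) := by
      rw [apply_sharp, apply_sharp, ← hs.eq]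
    constructor
    · rintro ⟨rfl, rfl, rfl, rfl⟩ ⟨⟨⟨v', e'⟩, ⟨p', f'⟩⟩, ⟨⟨v₁', c'⟩, ⟨p₁', f₁'⟩⟩⟩ ⟨h1, h2, h3, h4⟩
      simp only at h1 h2 h3 h4
      subst h1 h2 h3 h4
      simp only
      rw [hs' c e', hs' c' e]
      ring
    · intro h
      refine ⟨dual_ext fun μ => ?_, dual_ext fun μ => ?_, dual_ext fun μ => ?_, ?_⟩
      · have := h (((0, 0), (0, μ)), ((0, 0), (0, μ))) (by simp)
        simp only [map_zero, LinearMap.zero_apply] at this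
        linarith
      · have := h (((0, μ), (0, 0)), ((0, 0), (sharp β μ, 0))) (by simp)
        simp only [map_zero, LinearMap.zero_apply] at this
        rw [hs' c μ]
        linarith
      · have := h (((0, 0), (sharp β μ, 0)), ((0, μ), (0, 0))) (by simp)
        simp only [map_zero, LinearMap.zero_apply] at this
        rw [hs' e μ]
        linarith
      · ext x
        have := h (((x, 0), (0, 0)), ((x, 0), (0, 0))) (by simp)
        simp only [map_zero, LinearMap.zero_apply] at this
        linarith
  involutive := by
    rintro ⟨⟨⟨v, e⟩, ⟨p, f⟩⟩, ⟨⟨v₁, c⟩, ⟨p₁, f₁⟩⟩⟩ h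
      ⟨⟨⟨v', e'⟩, ⟨p', f'⟩⟩, ⟨⟨v₁', c'⟩, ⟨p₁', f₁'⟩⟩⟩ h'
    rw [model_mem_poissonRelation] at h h'
    obtain ⟨h1, h2, h3, h4⟩ := h
    obtain ⟨h1', h2', h3', h4'⟩ := h'
    simp only at h1 h2 h3 h4 h1' h2' h3' h4'
    subst h1 h2 h3 h4 h1' h2' h3' h4'
    simp only [model_mem_poissonRelation, MetricBracket.prod, MetricBracket.bar,
      MetricBracket.tangent, semidirect, LinearMap.mk₂_apply, true_and, map_sub, sharp_lie hβ,
      Prod.fst_add, Prod.snd_add]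
    refine ⟨?_, ?_, ?_⟩
    · rw [← lie_skew _ v']; abel
    · rw [← lie_skew _ v']; abel
    · rw [sharp_lie_swap hs hβ c' e, sharp_lie_swap hs hβ c e']; abel

lemma model_isLieAlgebroid : (model 𝔤 β).IsLieAlgebroid where
  anchor_smooth := smooth_of_linear (sharp β ∘ₗ LinearMap.snd ℝ 𝔤 (Module.Dual ℝ 𝔤))
  anchor_add v x y := map_add (sharp β) x.1.2 y.1.2
  anchor_smul t v x := map_smul (sharp β) t x.1.2
  bracket_smooth σ τ hσ hτ := by
    rw [model_isSmoothSection_iff] at *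
    exact hσ.actionBracket (sharp β) hτ
  bracket_add σ τ υ hσ hτ hυ := by
    rw [model_isSmoothSection_iff] at *
    exact funext fun v => model_fibre_ext (actionBracket_add_right (sharp β) hσ hτ hυ v)
  bracket_smul t σ τ hσ hτ := by
    rw [model_isSmoothSection_iff] at *
    refine funext fun v => model_fibre_ext ?_
    have h := actionBracket_smul_right (sharp β) hσ hτ (smooth_const t) v
    rw [dirDeriv_const, zero_smul, zero_add] at h
    exact h
  bracket_skew σ τ hσ hτ := funext fun v => model_fibre_ext (neg_sub _ _).symm
  jacobi σ τ υ hσ hτ hυ := by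
    rw [model_isSmoothSection_iff] at *
    exact funext fun v => model_fibre_ext (actionBracket_jacobi (sharp β) hσ hτ hυ v)
  leibniz σ τ f hσ hτ hf := by
    rw [model_isSmoothSection_iff] at *
    refine funext fun v => model_fibre_ext ?_
    rw [lineDeriv_eq_dirDeriv hf]
    exact actionBracket_smul_right (sharp β) hσ hτ hf v

lemma model_poisson (q : (model 𝔤 β).DualBundle) (p p' : (model 𝔤 β).DualCovector) :
    (model 𝔤 β).poisson q p p' = p'.1 (coreSharp β p.2) - p.1 (coreSharp β p'.2) :=
  Data.poisson_eq (fun d => (coreSharp_coreMap d).symm) model_bracket_coreSection q p p'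

lemma model_isLACourant (hs : β.IsSymm) (hβ : β.lieInvariant 𝔤) :
    (model 𝔤 β).IsLACourant where
  vbCourant := ⟨semidirect_isCourantAlgebroid, model_graphFibreAdd_isDirac⟩
  laVectorBundle := ⟨model_isLieAlgebroid, by
    rw [Data.graph_add_isCoisotropic_iff]
    intros
    simp only [model_poisson, map_add, LinearMap.neg_apply]
    ring⟩
  courantRelation := model_poissonRelation_isDirac hs hβ

/-! ### Isomorphisms between models. -/

lemma model_isIso_iff {𝔤' : Type*} [LieRing 𝔤'] [LieAlgebra ℝ 𝔤'] [FiniteDimensional ℝ 𝔤']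
    {β' : LinearMap.BilinForm ℝ (Module.Dual ℝ 𝔤')}
    {Φ : (𝔤 × Module.Dual ℝ 𝔤) ≃ₗ[ℝ] 𝔤' × Module.Dual ℝ 𝔤'} {φ : 𝔤 ≃ₗ[ℝ] 𝔤'} :
    (model 𝔤 β).IsIso (model 𝔤' β') Φ φ ↔
      (∀ x y, φ ⁅x, y⁆ = ⁅φ x, φ y⁆) ∧
      (∀ μ ν : Module.Dual ℝ 𝔤', β' μ ν = β (μ ∘ₗ φ.toLinearMap) (ν ∘ₗ φ.toLinearMap)) ∧
      ∀ x μ, Φ (x, μ) = (φ x, μ ∘ₗ φ.symm.toLinearMap) := by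
  constructor
  · intro h
    have h0 (x : 𝔤) : Φ (x, 0) = (φ x, 0) := by
      -- Fibrewise multiplication by zero is the projection to the zero section. Pairing with
      -- zero-section elements then determines `Φ` on the dual.
      have h1 := h.map_fibre_smul 0 x ⟨(x, 0), rfl⟩ ⟨Φ (x, 0), h.map_proj _⟩ rfl
      rwa [zero_smul, zero_smul] at h1
    have hΦ (x : 𝔤) (μ : Module.Dual ℝ 𝔤) : Φ (x, μ) = (φ x, μ ∘ₗ φ.symm.toLinearMap) := by
      refine Prod.ext (h.map_proj (x, μ)) ?_
      ext y
      have h1 := h.map_metric (x, μ) (φ.symm y, 0)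
      rw [h0] at h1
      simpa [model, semidirect] using h1
    refine ⟨fun x y => ?_, fun μ ν => ?_, hΦ⟩
    · have h1 := h.map_courant (x, 0) (y, 0)
      rw [h0, h0] at h1
      simp only [model, semidirect, LinearMap.mk₂_apply, lie_zero, sub_zero, h0] at h1
      exact (congrArg Prod.fst h1).symm
    · have h1 : sharp β' (Φ (0, μ ∘ₗ φ.toLinearMap)).2 = φ (sharp β (μ ∘ₗ φ.toLinearMap)) :=
        h.map_anchor (0, μ ∘ₗ φ.toLinearMap)
      rw [hΦ] at h1
      have h2 : (μ ∘ₗ φ.toLinearMap) ∘ₗ φ.symm.toLinearMap = μ := by ext; simp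
      simp only [h2] at h1
      rw [← apply_sharp, ← apply_sharp, h1]
      rfl
  · rintro ⟨hφ, hβ', hΦ⟩
    have hΦ' (d : 𝔤 × Module.Dual ℝ 𝔤) : Φ d = (φ d.1, d.2 ∘ₗ φ.symm.toLinearMap) := hΦ d.1 d.2
    have hsharp (μ : Module.Dual ℝ 𝔤) :
        sharp β' (μ ∘ₗ φ.symm.toLinearMap) = φ (sharp β μ) := by
      refine dual_ext fun ν => ?_
      have h2 : (μ ∘ₗ φ.symm.toLinearMap) ∘ₗ φ.toLinearMap = μ := by ext; simp
      rw [apply_sharp, hβ', h2, ← apply_sharp]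
      rfl
    have hφ' (x y : 𝔤') : φ.symm ⁅x, y⁆ = ⁅φ.symm x, φ.symm y⁆ := by
      apply φ.injective
      rw [hφ]; simp
    refine ⟨fun d => by rw [hΦ']; rfl, fun v x y x' y' hx hy => ?_, fun t v x x' hx => ?_,
      fun d e => ?_, fun d e => ?_, fun d => ?_, ?_⟩
    · rw [hΦ'] at hx hy ⊢
      refine Prod.ext ?_ ?_
      · exact (congrArg φ (x + y).2).trans (x' + y').2.symm
      · change (x.1.2 + y.1.2) ∘ₗ _ = x'.1.2 + y'.1.2
        rw [← hx, ← hy]; rfl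
    · rw [hΦ'] at hx ⊢
      refine Prod.ext ?_ ?_
      · exact (congrArg φ (t • x).2).trans (t • x').2.symm
      · change (t • x.1.2) ∘ₗ _ = t • x'.1.2
        rw [← hx]; rfl
    · rw [hΦ', hΦ']
      simp [model, semidirect]
    · rw [hΦ', hΦ', hΦ']
      refine Prod.ext ?_ ?_
      · simp [model, semidirect, hφ]
      · ext x
        simp [model, semidirect, hφ']
    · rw [hΦ']
      exact hsharp d.2
    · intro σ τ σ' τ' hσ hτ hσ' hτ' hσσ' hττ' v
      rw [model_isSmoothSection_iff] at hσ hτ hσ' hτ'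
      let ψ : Module.Dual ℝ 𝔤 →ₗ[ℝ] Module.Dual ℝ 𝔤' := φ.symm.toLinearMap.dualMap
      -- The related sections are the transports by `ψ` and `φ`, so the chain rule compares the
      -- brackets.
      have h1 : (fun v => (σ' v).1.2) = fun v => ψ (σ (φ.symm v)).1.2 := funext fun v => by
        have := hσσ' (φ.symm v)
        rw [φ.apply_symm_apply, hΦ'] at this
        rw [← this]; rfl
      have h2 : (fun v => (τ' v).1.2) = fun v => ψ (τ (φ.symm v)).1.2 := funext fun v => by
        have := hττ' (φ.symm v)
        rw [φ.apply_symm_apply, hΦ'] at this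
        rw [← this]; rfl
      rw [hΦ']
      refine Prod.ext ?_ ?_
      · exact (congrArg φ ((model 𝔤 β).bracket σ τ v).2).trans
          ((model 𝔤' β').bracket σ' τ' (φ v)).2.symm
      · change ψ ((model 𝔤 β).bracket σ τ v).1.2 = _
        rw [model_bracket, model_bracket σ' τ', h1, h2]
        have h3 (μ : Module.Dual ℝ 𝔤) : sharp β' (ψ μ) = φ (sharp β μ) := hsharp μ
        have h4 := dirDeriv_linear_comp ψ φ.symm.toLinearMap hσ (φ v)
        have h5 := dirDeriv_linear_comp ψ φ.symm.toLinearMap hτ (φ v)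
        simp only [LinearEquiv.coe_coe] at h4 h5
        have h6 : (σ (φ.symm (φ v))).1.2 = (σ v).1.2 :=
          congrArg (fun w => (σ w).1.2) (φ.symm_apply_apply v)
        have h7 : (τ (φ.symm (φ v))).1.2 = (τ v).1.2 :=
          congrArg (fun w => (τ w).1.2) (φ.symm_apply_apply v)
        simp only [actionBracket, h3, h4, h5, h6, h7, φ.symm_apply_apply, map_sub]

/-! ### LA-Dirac structures of the model. -/

lemma model_coe_fibre_add {v : 𝔤} (x y : (model 𝔤 β).Fibre v) :
    ((x + y : (model 𝔤 β).Fibre v) : 𝔤 × Module.Dual ℝ 𝔤) = (v, x.1.2 + y.1.2) := rfl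

lemma model_coe_fibre_smul (t : ℝ) {v : 𝔤} (x : (model 𝔤 β).Fibre v) :
    ((t • x : (model 𝔤 β).Fibre v) : 𝔤 × Module.Dual ℝ 𝔤) = (v, t • x.1.2) := rfl

lemma model_isSubbundle_prod (W : Submodule ℝ 𝔤) (K : Submodule ℝ (Module.Dual ℝ 𝔤)) :
    (model 𝔤 β).IsSubbundle ((W : Set 𝔤) ×ˢ (K : Set (Module.Dual ℝ 𝔤))) where
  zero_mem := ⟨W.zero_mem, K.zero_mem⟩
  add_mem _ hx _ hy := ⟨W.add_mem hx.1 hy.1, K.add_mem hx.2 hy.2⟩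
  smul_mem t _ hx := ⟨W.smul_mem t hx.1, K.smul_mem t hx.2⟩
  fibre_add_mem v x y hx hy := by
    rw [model_coe_fibre_add]
    exact ⟨(congrArg (· ∈ (W : Set 𝔤)) x.2).mp hx.1, K.add_mem hx.2 hy.2⟩
  fibre_smul_mem t v x hx := by
    rw [model_coe_fibre_smul]
    exact ⟨(congrArg (· ∈ (W : Set 𝔤)) x.2).mp hx.1, K.smul_mem t hx.2⟩

/-- Fibrewise multiplication by zero puts `(x, 0)` in `L` along with `(x, μ)`; subtracting in the
vector space then gives `(0, μ)`. -/
lemma model_subbundle_eq_prod {L : Set (𝔤 × Module.Dual ℝ 𝔤)}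
    (hL : (model 𝔤 β).IsSubbundle L) : ∃ (W : Submodule ℝ 𝔤) (K : Submodule ℝ (Module.Dual ℝ 𝔤)),
      L = (W : Set 𝔤) ×ˢ (K : Set (Module.Dual ℝ 𝔤)) := by
  have h0 (x : 𝔤) (μ : Module.Dual ℝ 𝔤) (h : (x, μ) ∈ L) : (x, (0 : Module.Dual ℝ 𝔤)) ∈ L := by
    have := hL.fibre_smul_mem 0 x ⟨(x, μ), rfl⟩ h
    rwa [model_coe_fibre_smul, zero_smul] at this
  refine ⟨{ carrier := {x | (x, 0) ∈ L}, zero_mem' := hL.zero_mem, add_mem' := ?_, smul_mem' := ?_ },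
    { carrier := {μ | (0, μ) ∈ L}, zero_mem' := hL.zero_mem, add_mem' := ?_, smul_mem' := ?_ }, ?_⟩
  · intro x y hx hy
    simpa using hL.add_mem _ hx _ hy
  · intro t x hx
    simpa using hL.smul_mem t _ hx
  · intro x y hx hy
    simpa using hL.add_mem _ hx _ hy
  · intro t x hx
    simpa using hL.smul_mem t _ hx
  · ext ⟨x, μ⟩
    constructor
    · intro h
      refine ⟨h0 x μ h, ?_⟩
      have := hL.add_mem _ h _ (hL.smul_mem (-1) _ (h0 x μ h))
      simpa using this
    · rintro ⟨h, h'⟩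
      have := hL.add_mem _ h _ h'
      simpa using this

/-- The core component of an element of the dual of the Lie algebra. -/
noncomputable def dualToCore (β : LinearMap.BilinForm ℝ (Module.Dual ℝ 𝔤)) :
    Module.Dual ℝ 𝔤 →ₗ[ℝ] (model 𝔤 β).Core :=
  (model 𝔤 β).coreMap ∘ₗ LinearMap.inr ℝ 𝔤 (Module.Dual ℝ 𝔤)

lemma coreSharp_dualToCore (μ : Module.Dual ℝ 𝔤) : coreSharp β (dualToCore β μ) = sharp β μ :=
  coreSharp_coreMap (0, μ)

lemma model_coreMap (d : 𝔤 × Module.Dual ℝ 𝔤) : (model 𝔤 β).coreMap d = dualToCore β d.2 :=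
  model_coreMap_eq_iff.2 rfl

lemma model_annihilator (W : Submodule ℝ 𝔤) (K : Submodule ℝ (Module.Dual ℝ 𝔤)) :
    (model 𝔤 β).annihilator ((W : Set 𝔤) ×ˢ (K : Set (Module.Dual ℝ 𝔤))) =
      (W.prod (K.map (dualToCore β)).dualAnnihilator : Set (model 𝔤 β).DualBundle) := by
  ext ⟨x, ξ⟩
  simp only [DoubleVB.annihilator, DoubleVB.corePart_eq_coreMap, model_coreMap]
  simp only [Submodule.prod_coe, Set.mem_prod, SetLike.mem_coe, Submodule.mem_dualAnnihilator,
    Submodule.mem_map, forall_exists_index, and_imp, forall_apply_eq_imp_iff₂]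
  constructor
  · rintro ⟨⟨d, hd, rfl⟩, h⟩
    exact ⟨hd.1, fun μ hμ => h (d.1, μ) hd.1 hμ rfl⟩
  · rintro ⟨h1, h2⟩
    exact ⟨⟨(x, 0), ⟨h1, K.zero_mem⟩, rfl⟩, fun d _ hd _ => h2 _ hd⟩

/-- By biduality the conormal space of the annihilator is `ann W × K`. The constant bivector
vanishes on it exactly when `ann W` kills `sharp β K`, that is, when `sharp β K ⊆ W`. -/
lemma model_isLieSubalgebroid_iff (W : Submodule ℝ 𝔤) (K : Submodule ℝ (Module.Dual ℝ 𝔤)) :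
    (model 𝔤 β).IsLieSubalgebroid ((W : Set 𝔤) ×ˢ (K : Set (Module.Dual ℝ 𝔤))) ↔
      ∀ μ ∈ K, sharp β μ ∈ W := by
  rw [Data.IsLieSubalgebroid, model_annihilator, isCoisotropic_submodule]
  have key (α : Module.Dual ℝ 𝔤) (c : (model 𝔤 β).Core) :
      (∀ h ∈ W.prod (K.map (dualToCore β)).dualAnnihilator,
        (model 𝔤 β).covEval (α, c) h = 0) ↔
      α ∈ W.dualAnnihilator ∧ ∃ μ ∈ K, dualToCore β μ = c := by
    have hK : (∃ μ ∈ K, dualToCore β μ = c) ↔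
        ∀ ξ ∈ (K.map (dualToCore β)).dualAnnihilator, ξ c = 0 := by
      rw [← Submodule.mem_map]
      exact (Subspace.forall_mem_dualAnnihilator_apply_eq_zero_iff _ c).symm
    rw [hK, Submodule.mem_dualAnnihilator]
    simp only [DoubleVB.covEval]
    constructor
    · intro h
      refine ⟨fun x hx => ?_, fun ξ hξ => ?_⟩
      · simpa using h (x, 0) ⟨hx, Submodule.zero_mem _⟩
      · simpa using h (0, ξ) ⟨W.zero_mem, hξ⟩
    · rintro ⟨h1, h2⟩ ⟨x, ξ⟩ ⟨hx, hξ⟩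
      rw [h1 x hx, h2 ξ hξ, add_zero]
  constructor
  · intro h μ hμ
    rw [← Subspace.dualAnnihilator_dualCoannihilator_eq (W := W),
      Submodule.mem_dualCoannihilator]
    intro α hα
    have := h 0 (Submodule.zero_mem _) (0, dualToCore β μ) (α, 0)
      ((key _ _).2 ⟨Submodule.zero_mem _, μ, hμ, rfl⟩)
      ((key _ _).2 ⟨hα, 0, K.zero_mem, map_zero _⟩)
    simpa [model_poisson, coreSharp_dualToCore] using this
  · rintro h q - ⟨α, c⟩ ⟨α', c'⟩ hp hp'
    obtain ⟨hα, μ, hμ, rfl⟩ := (key _ _).1 hp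
    obtain ⟨hα', μ', hμ', rfl⟩ := (key _ _).1 hp'
    rw [Submodule.mem_dualAnnihilator] at hα hα'
    simp only [model_poisson, coreSharp_dualToCore]
    rw [hα _ (h _ hμ'), hα' _ (h _ hμ), sub_zero]

omit [FiniteDimensional ℝ 𝔤] in
lemma model_isDirac_iff (W : Submodule ℝ 𝔤) (K : Submodule ℝ (Module.Dual ℝ 𝔤)) :
    (semidirect 𝔤).IsDirac ((W : Set 𝔤) ×ˢ (K : Set (Module.Dual ℝ 𝔤))) ↔
      K = W.dualAnnihilator ∧ ∀ x ∈ W, ∀ y ∈ W, ⁅x, y⁆ ∈ W := by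
  constructor
  · intro h
    refine ⟨?_, fun x hx y hy => (h.involutive (x, 0) ⟨hx, K.zero_mem⟩ (y, 0) ⟨hy, K.zero_mem⟩).1⟩
    ext μ
    rw [Submodule.mem_dualAnnihilator]
    have h1 := h.lagrangian (0, μ)
    simp only [semidirect, LinearMap.mk₂_apply, map_zero, add_zero] at h1
    constructor
    · exact fun hμ x hx => h1.1 ⟨W.zero_mem, hμ⟩ (x, 0) ⟨hx, K.zero_mem⟩
    · exact fun hμ => (h1.2 fun d hd => hμ d.1 hd.1).2
  · rintro ⟨rfl, h⟩
    constructor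
    · rintro ⟨x, μ⟩
      simp only [semidirect, LinearMap.mk₂_apply]
      constructor
      · rintro ⟨hx, hμ⟩ ⟨y, ν⟩ ⟨hy, hν⟩
        simp only [SetLike.mem_coe, Submodule.mem_dualAnnihilator] at hx hμ hy hν
        rw [hμ y hy, hν x hx, add_zero]
      · intro H
        constructor
        · rw [SetLike.mem_coe, ← Subspace.dualAnnihilator_dualCoannihilator_eq (W := W),
            Submodule.mem_dualCoannihilator]
          intro ν hν
          simpa using H (0, ν) ⟨W.zero_mem, hν⟩
        · rw [SetLike.mem_coe, Submodule.mem_dualAnnihilator]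
          intro y hy
          simpa using H (y, 0) ⟨hy, Submodule.zero_mem _⟩
    · rintro ⟨x, μ⟩ ⟨hx, hμ⟩ ⟨y, ν⟩ ⟨hy, hν⟩
      simp only [SetLike.mem_coe, Submodule.mem_dualAnnihilator] at hx hμ hy hν
      simp only [semidirect, LinearMap.mk₂_apply]
      refine ⟨h x hx y hy, ?_⟩
      rw [SetLike.mem_coe, Submodule.mem_dualAnnihilator]
      intro z hz
      simp only [LinearMap.sub_apply, Module.Dual.lie_apply]
      rw [hν _ (h x hx z hz), hμ _ (h y hy z hz), sub_self]

lemma model_isLADirac_iff (L : Set (𝔤 × Module.Dual ℝ 𝔤)) :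
    (model 𝔤 β).IsLADirac L ↔ ∃! 𝔥 : LieSubalgebra ℝ 𝔤, IsCoisotropicSubalgebra β 𝔥 ∧
      L = (𝔥 : Set 𝔤) ×ˢ (𝔥.toSubmodule.dualAnnihilator : Set (Module.Dual ℝ 𝔤)) := by
  constructor
  · rintro ⟨h1, h2, h3⟩
    obtain ⟨W, K, rfl⟩ := model_subbundle_eq_prod h1
    obtain ⟨rfl, hW⟩ := (model_isDirac_iff W K).1 h2
    rw [model_isLieSubalgebroid_iff] at h3
    refine ⟨{ W with lie_mem' := fun {x y} hx hy => hW x hx y hy }, ⟨h3, rfl⟩, ?_⟩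
    -- The subalgebra is recovered from `L` as the set of `x` with `(x, 0) ∈ L`.
    rintro 𝔥 ⟨-, h⟩
    ext x
    have hx := Set.ext_iff.1 h (x, 0)
    simpa using hx.symm
  · rintro ⟨𝔥, ⟨h, rfl⟩, -⟩
    exact ⟨model_isSubbundle_prod 𝔥.toSubmodule _,
      (model_isDirac_iff 𝔥.toSubmodule _).2 ⟨rfl, fun x hx y hy => 𝔥.lie_mem hx hy⟩,
      (model_isLieSubalgebroid_iff 𝔥.toSubmodule _).2 h⟩

end Model

/-! ### The Courant structure in the splitting, and the Lie algebra `V`. -/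

namespace Data

section VBCourant

variable {V : Type*} {𝔸 : Type*} [AddCommGroup V] [Module ℝ V] [FiniteDimensional ℝ V]
  [AddCommGroup 𝔸] [Module ℝ 𝔸] [FiniteDimensional ℝ 𝔸] {A : Data V 𝔸} (h : A.IsVBCourant)

include h

lemma IsVBCourant.metric_graph {z z' : 𝔸 × 𝔸 × 𝔸} (hz : z ∈ A.graphFibreAdd)
    (hz' : z' ∈ A.graphFibreAdd) : A.courant.metric z.1 z'.1 =
      A.courant.metric z.2.1 z'.2.1 + A.courant.metric z.2.2 z'.2.2 := by
  have h1 := (h.graph_add.lagrangian z).1 hz z' hz'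
  simp only [MetricBracket.prod, MetricBracket.bar, LinearMap.mk₂_apply,
    LinearMap.neg_apply] at h1
  linarith

lemma IsVBCourant.bracket_graph {z z' : 𝔸 × 𝔸 × 𝔸} (hz : z ∈ A.graphFibreAdd)
    (hz' : z' ∈ A.graphFibreAdd) : (A.courant.bracket z.1 z'.1,
      A.courant.bracket z.2.1 z'.2.1, A.courant.bracket z.2.2 z'.2.2) ∈ A.graphFibreAdd :=
  h.graph_add.involutive z hz z' hz'

omit h in
lemma zeroSection_mem_graph (x : V) :
    (A.zeroSection x, A.zeroSection x, A.zeroSection x) ∈ A.graphFibreAdd := by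
  simp [DoubleVB.mem_graphFibreAdd]

omit h in
lemma core_left_mem_graph (c : A.Core) : ((c : 𝔸), (c : 𝔸), (0 : 𝔸)) ∈ A.graphFibreAdd := by
  simp [DoubleVB.mem_graphFibreAdd]

omit h in
lemma core_right_mem_graph (c : A.Core) : ((c : 𝔸), (0 : 𝔸), (c : 𝔸)) ∈ A.graphFibreAdd := by
  simp [DoubleVB.mem_graphFibreAdd]

/-- Diagonal triples of zero vectors lie in the graph, so the pairing equals its own double. This
lemma and the next four all evaluate the graph condition on such triples and on `(c; c, 0)`, `(c; 0,
c)`. -/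
lemma IsVBCourant.metric_zeroSection (x y : V) :
    A.courant.metric (A.zeroSection x) (A.zeroSection y) = 0 := by
  have := h.metric_graph (zeroSection_mem_graph x) (zeroSection_mem_graph y)
  simp only at this
  linarith

lemma IsVBCourant.metric_core (c c' : A.Core) : A.courant.metric c c' = 0 := by
  have := h.metric_graph (core_left_mem_graph c) (core_right_mem_graph c')
  simpa using this

lemma IsVBCourant.zeroSection_proj_bracket (x y : V) :
    A.zeroSection (A.proj (A.courant.bracket (A.zeroSection x) (A.zeroSection y))) =
      A.courant.bracket (A.zeroSection x) (A.zeroSection y) := by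
  have := h.bracket_graph (zeroSection_mem_graph x) (zeroSection_mem_graph y)
  rw [DoubleVB.mem_graphFibreAdd] at this
  refine DoubleVB.ext_proj_coreMap (D := A.toDoubleVB) (A.proj_zeroSection _) ?_
  rw [A.coreMap_zeroSection]
  exact (left_eq_add.1 this.2.2).symm

lemma IsVBCourant.proj_bracket_core (x : V) (c : A.Core) :
    A.proj (A.courant.bracket (A.zeroSection x) c) = 0 := by
  have := h.bracket_graph (zeroSection_mem_graph x) (core_left_mem_graph c)
  rw [DoubleVB.mem_graphFibreAdd] at this
  simpa using this.2.1.symm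

lemma IsVBCourant.bracket_core_core (c c' : A.Core) : A.courant.bracket (c : 𝔸) c' = 0 := by
  have := h.bracket_graph (core_left_mem_graph c) (core_right_mem_graph c')
  rw [DoubleVB.mem_graphFibreAdd] at this
  simp only [map_zero, LinearMap.zero_apply, add_zero] at this
  exact DoubleVB.ext_proj_coreMap (D := A.toDoubleVB) (by rw [map_zero, ← this.1])
    (by rw [map_zero, this.2.2])

/-- The Lie bracket on the side bundle of a VB-Courant algebroid over a point. -/
abbrev IsVBCourant.lieRing : LieRing V :=
  -- The given additive group is kept, so that the bundle over `V` is still a bundle over the Lie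
  -- algebra.
  { (inferInstance : AddCommGroup V) with
    bracket x y := A.proj (A.courant.bracket (A.zeroSection x) (A.zeroSection y))
    add_lie x y z := by
      change A.proj _ = A.proj _ + A.proj _
      rw [map_add, map_add, LinearMap.add_apply, map_add]
    lie_add x y z := by
      change A.proj _ = A.proj _ + A.proj _
      rw [map_add, map_add, map_add]
    lie_self x := by
      change A.proj _ = 0
      have h1 := h.courantAlgebroid.bracket_add_swap (A.zeroSection x) (A.zeroSection x)
      rw [← two_smul ℝ, smul_eq_zero] at h1
      rw [h1.resolve_left two_ne_zero, map_zero]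
    leibniz_lie x y z := by
      change A.proj (A.courant.bracket _ (A.zeroSection (A.proj _))) =
        A.proj (A.courant.bracket (A.zeroSection (A.proj _)) _) +
        A.proj (A.courant.bracket _ (A.zeroSection (A.proj _)))
      simp only [h.zeroSection_proj_bracket]
      rw [h.courantAlgebroid.jacobi, map_add] }

/-- The Lie bracket on the side bundle is bilinear over `ℝ`. -/
abbrev IsVBCourant.lieAlgebra : @LieAlgebra ℝ V _ h.lieRing :=
  letI := h.lieRing
  { (inferInstance : Module ℝ V) with
    lie_smul t x y := by
      change A.proj (A.courant.bracket (A.zeroSection x) (A.zeroSection (t • y))) = t • A.proj _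
      rw [map_smul, map_smul, map_smul] }

end VBCourant

/-! ### The Lie algebroid structure in the splitting. -/

section LieAlgebroid

variable {V : Type*} {𝔸 : Type*} [AddCommGroup V] [Module ℝ V] [FiniteDimensional ℝ V]
  [AddCommGroup 𝔸] [Module ℝ 𝔸] [FiniteDimensional ℝ 𝔸] {A : Data V 𝔸}

lemma coe_coreSection_coreMap (d : 𝔸) :
    (A.coreSection (A.coreMap d) (A.proj d) : 𝔸) = d :=
  A.zeroSection_add_corePart d

lemma isSmoothSection_coreSection (c : A.Core) : A.IsSmoothSection (A.coreSection c) :=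
  A.isSmoothSection_sectionOfCore (smooth_const c)

lemma IsLAVectorBundle.anchor_coreSection_add (h : A.IsLAVectorBundle) (v v' : V)
    (c c' : A.Core) : A.anchor (A.coreSection (c + c') (v + v')) =
      A.anchor (A.coreSection c v) + A.anchor (A.coreSection c' v') := by
  refine dual_ext fun α => ?_
  -- Pure core covectors against pure base covectors, at `ξ = 0`: only anchor terms survive.
  have h1 := graph_add_isCoisotropic_iff A |>.1 h.graph_add v v' 0 0 α c c' 0 0
  simp only [poisson, LinearMap.zero_apply, LinearMap.neg_apply, neg_zero] at h1
  rw [map_add]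
  linarith

lemma IsLieAlgebroid.anchor_zero (h : A.IsLieAlgebroid) (v : V) :
    A.anchor (A.coreSection 0 v) = 0 := by
  have h1 := h.anchor_smul 0 v (A.coreSection 0 v)
  rw [zero_smul, zero_smul] at h1
  rw [A.coe_coreSection, Submodule.coe_zero, add_zero]
  exact h1

/-- The anchor is determined by a linear map on the core. -/
lemma IsLAVectorBundle.exists_coreAnchor (h : A.IsLAVectorBundle) :
    ∃ a : A.Core →ₗ[ℝ] V, ∀ d, A.anchor d = a (A.coreMap d) := by
  refine ⟨{ toFun c := A.anchor (A.coreSection c 0), map_add' := fun c c' => ?_,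
            map_smul' := fun t c => ?_ }, fun d => ?_⟩
  · have h1 := h.anchor_coreSection_add 0 0 c c'
    rwa [add_zero] at h1
  · rw [RingHom.id_apply, ← h.lieAlgebroid.anchor_smul]
    congr 2
    exact DoubleVB.fibre_ext (by rw [A.coreMap_coe_smul, A.coreMap_coreSection,
      A.coreMap_coreSection])
  -- Split `d` into its core component and a zero vector, where the anchor vanishes; the base point
  -- drops out.
  · have h1 := h.anchor_coreSection_add 0 (A.proj d) (A.coreMap d) 0
    rw [h.lieAlgebroid.anchor_zero, add_zero, add_zero, zero_add, coe_coreSection_coreMap] at h1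
    exact h1

lemma IsLieAlgebroid.bracket_zero (h : A.IsLieAlgebroid) {σ : ∀ v, A.Fibre v}
    (hσ : A.IsSmoothSection σ) : A.bracket σ 0 = 0 := by
  have h1 := h.bracket_smul 0 σ σ hσ hσ
  rwa [zero_smul, zero_smul] at h1

lemma coreSection_zero : A.coreSection (0 : A.Core) = 0 :=
  funext fun v => DoubleVB.fibre_ext (by
    rw [A.coreMap_coreSection, Pi.zero_apply, A.coe_zero, A.coreMap_zeroSection])

/-- Placing `c` in the first summand and `c'` in the second expresses the bracket through brackets
in which one section is zero. -/
lemma IsLAVectorBundle.bracket_coreSection (h : A.IsLAVectorBundle) (c c' : A.Core) (v : V) :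
    A.coreMap (A.bracket (A.coreSection c) (A.coreSection c') v : 𝔸) = 0 := by
  refine dual_ext fun ξ => ?_
  have h1 := graph_add_isCoisotropic_iff A |>.1 h.graph_add v 0 ξ 0 0 c 0 0 c'
  have hz := isSmoothSection_coreSection (A := A) 0
  have h2 : A.bracket (A.coreSection 0) (A.coreSection c') = 0 := by
    rw [h.lieAlgebroid.bracket_skew _ _ hz (isSmoothSection_coreSection c'), coreSection_zero,
      h.lieAlgebroid.bracket_zero (isSmoothSection_coreSection c'), neg_zero]
  have h3 : A.bracket (A.coreSection c) (A.coreSection 0) = 0 := by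
    rw [coreSection_zero, h.lieAlgebroid.bracket_zero (isSmoothSection_coreSection c)]
  simp only [poisson, h2, h3, LinearMap.zero_apply, neg_zero, zero_add, add_zero, sub_zero,
    A.corePart_eq_coreMap, Pi.zero_apply, A.coe_zero, A.coreMap_zeroSection, map_zero] at h1
  rw [add_zero] at h1
  rw [h1, map_zero]

lemma IsLieAlgebroid.coreMap_bracket_add (h : A.IsLieAlgebroid) {s t t' : V → A.Core}
    (hs : Smooth s) (ht : Smooth t) (ht' : Smooth t') (v : V) :
    A.coreMap (A.bracket (A.sectionOfCore s) (A.sectionOfCore fun x => t x + t' x) v : 𝔸) =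
      A.coreMap (A.bracket (A.sectionOfCore s) (A.sectionOfCore t) v : 𝔸) +
      A.coreMap (A.bracket (A.sectionOfCore s) (A.sectionOfCore t') v : 𝔸) := by
  have h1 : (A.sectionOfCore fun x => t x + t' x) = A.sectionOfCore t + A.sectionOfCore t' :=
    funext fun x => DoubleVB.fibre_ext (by simp)
  rw [h1, h.bracket_add _ _ _ (A.isSmoothSection_sectionOfCore hs)
    (A.isSmoothSection_sectionOfCore ht) (A.isSmoothSection_sectionOfCore ht'), Pi.add_apply,
    A.coreMap_coe_add]

lemma IsLieAlgebroid.coreMap_bracket_smul (h : A.IsLieAlgebroid) {s t : V → A.Core} {f : V → ℝ}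
    (hs : Smooth s) (ht : Smooth t) (hf : Smooth f) (v : V) :
    A.coreMap (A.bracket (A.sectionOfCore s) (A.sectionOfCore fun x => f x • t x) v : 𝔸) =
      dirDeriv f v (A.anchor (A.sectionOfCore s v)) • t v +
      f v • A.coreMap (A.bracket (A.sectionOfCore s) (A.sectionOfCore t) v : 𝔸) := by
  have h1 : (A.sectionOfCore fun x => f x • t x) = fun x => f x • A.sectionOfCore t x :=
    funext fun x => DoubleVB.fibre_ext (by simp)
  rw [h1, h.leibniz _ _ _ (A.isSmoothSection_sectionOfCore hs)
    (A.isSmoothSection_sectionOfCore ht) hf, A.coreMap_coe_add, A.coreMap_coe_smul,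
    A.coreMap_coe_smul, A.coreMap_sectionOfCore, lineDeriv_eq_dirDeriv hf]

/-- The bracket of sections is that of the action Lie algebroid of the abelian Lie algebra given
by the core. -/
lemma IsLAVectorBundle.coreMap_bracket (h : A.IsLAVectorBundle) {a : A.Core →ₗ[ℝ] V}
    (ha : ∀ d, A.anchor d = a (A.coreMap d)) {σ τ : ∀ v, A.Fibre v} (hσ : A.IsSmoothSection σ)
    (hτ : A.IsSmoothSection τ) (v : V) : A.coreMap (A.bracket σ τ v : 𝔸) =
      actionBracket a (fun x => A.coreMap (σ x : 𝔸)) (fun x => A.coreMap (τ x : 𝔸)) v := by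
  have hL := h.lieAlgebroid
  -- Both brackets vanish on constant sections and obey the Leibniz rule. `smooth_induction` frees
  -- the second argument; skew-symmetry and a second induction free the first.
  have key₁ (c : A.Core) {t : V → A.Core} (ht : Smooth t) :
      ∀ v, A.coreMap (A.bracket (A.coreSection c) (A.sectionOfCore t) v : 𝔸) =
        actionBracket a (fun _ => c) t v := by
    refine smooth_induction (P := fun t => ∀ v, A.coreMap
      (A.bracket (A.coreSection c) (A.sectionOfCore t) v : 𝔸) = actionBracket a (fun _ => c) t v)
      (fun f c' hf v => ?_) (fun t t' ht ht' h1 h2 v => ?_) ht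
    · rw [← A.sectionOfCore_const, hL.coreMap_bracket_smul (smooth_const c) (smooth_const c') hf,
        actionBracket_smul_right a (smooth_const c) (smooth_const c') hf, actionBracket_const, ha,
        A.coreMap_sectionOfCore, A.sectionOfCore_const, A.sectionOfCore_const,
        h.bracket_coreSection]
    · rw [actionBracket_add_right a (smooth_const c) ht ht', ← h1, ← h2]
      exact hL.coreMap_bracket_add (smooth_const c) ht ht' v
  have key₂ {s t : V → A.Core} (hs : Smooth s) (ht : Smooth t) :
      ∀ v, A.coreMap (A.bracket (A.sectionOfCore s) (A.sectionOfCore t) v : 𝔸) =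
        actionBracket a s t v := by
    refine smooth_induction (P := fun t => ∀ v, A.coreMap
      (A.bracket (A.sectionOfCore s) (A.sectionOfCore t) v : 𝔸) = actionBracket a s t v)
      (fun f c hf v => ?_) (fun t t' ht ht' h1 h2 v => ?_) ht
    · rw [hL.coreMap_bracket_smul hs (smooth_const c) hf,
        actionBracket_smul_right a hs (smooth_const c) hf, ha, A.coreMap_sectionOfCore,
        hL.bracket_skew _ _ (A.isSmoothSection_sectionOfCore hs)
          (A.isSmoothSection_sectionOfCore (smooth_const c)), Pi.neg_apply, A.coreMap_coe_neg,
        A.sectionOfCore_const, key₁ c hs, actionBracket, neg_sub]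
      rfl
    · rw [hL.coreMap_bracket_add hs ht ht', actionBracket_add_right a hs ht ht', h1, h2]
  rw [← key₂ (A.isSmoothSection_iff.1 hσ) (A.isSmoothSection_iff.1 hτ), A.sectionOfCore_coreMap,
    A.sectionOfCore_coreMap]

end LieAlgebroid

/-! ### Every LA-Courant algebroid over a point is a model. -/

section Classification

variable {V : Type*} {𝔸 : Type*} [LieRing V] [LieAlgebra ℝ V] [FiniteDimensional ℝ V]
  [AddCommGroup 𝔸] [Module ℝ 𝔸] [FiniteDimensional ℝ 𝔸] {A : Data V 𝔸}

/-- The pairing of the core with the side bundle. -/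
noncomputable def corePairing (A : Data V 𝔸) : A.Core →ₗ[ℝ] Module.Dual ℝ V :=
  A.courant.metric.compl₁₂ A.Core.subtype A.zeroSection

lemma corePairing_apply (c : A.Core) (x : V) :
    A.corePairing c x = A.courant.metric c (A.zeroSection x) := rfl

lemma zeroSection_proj_add_coreMap (d : 𝔸) : d = A.zeroSection (A.proj d) + A.coreMap d :=
  (A.zeroSection_add_corePart d).symm

lemma IsVBCourant.metric_eq (h : A.IsVBCourant) (d e : 𝔸) : A.courant.metric d e =
    A.corePairing (A.coreMap d) (A.proj e) + A.corePairing (A.coreMap e) (A.proj d) := by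
  conv_lhs => rw [zeroSection_proj_add_coreMap (A := A) d, zeroSection_proj_add_coreMap (A := A) e]
  rw [map_add, map_add, LinearMap.add_apply, LinearMap.add_apply, h.metric_zeroSection,
    h.metric_core, h.courantAlgebroid.metric_symm (A.zeroSection _), corePairing_apply,
    corePairing_apply]
  ring

/-- Core and side are isotropic, so nondegeneracy of the metric makes the pairing injective in both
variables, and the dimensions agree. -/
lemma IsVBCourant.corePairing_bijective (h : A.IsVBCourant) :
    Function.Bijective A.corePairing := by
  have h1 : Function.Injective A.corePairing := by
    rw [injective_iff_map_eq_zero]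
    intro c hc
    refine Subtype.ext (h.courantAlgebroid.metric_nondegenerate _ fun e => ?_)
    rw [h.metric_eq, A.coreMap_core, hc, A.proj_core, LinearMap.zero_apply, map_zero, add_zero]
  have h2 : Function.Injective A.corePairing.flip := by
    rw [injective_iff_map_eq_zero]
    intro x hx
    rw [← A.proj_zeroSection x, h.courantAlgebroid.metric_nondegenerate (A.zeroSection x),
      map_zero]
    intro e
    rw [h.metric_eq, A.coreMap_zeroSection, A.proj_zeroSection, map_zero, LinearMap.zero_apply,
      zero_add]
    exact LinearMap.congr_fun hx (A.coreMap e)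
  have h3 := LinearMap.finrank_le_finrank_of_injective h1
  have h4 := LinearMap.finrank_le_finrank_of_injective h2
  rw [Subspace.dual_finrank_eq] at h3 h4
  refine ⟨h1, (LinearMap.injective_iff_surjective_of_finrank_eq_finrank ?_).1 h1⟩
  rw [Subspace.dual_finrank_eq]
  exact le_antisymm h3 h4

lemma IsVBCourant.corePairing_bracket (h : A.IsVBCourant)
    (hlie : ∀ x y, A.zeroSection ⁅x, y⁆ = A.courant.bracket (A.zeroSection x) (A.zeroSection y))
    (x : V) (c : A.Core) :
    A.corePairing (A.coreMap (A.courant.bracket (A.zeroSection x) c)) = ⁅x, A.corePairing c⁆ := by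
  ext y
  have h1 : (A.coreMap (A.courant.bracket (A.zeroSection x) c) : 𝔸) =
      A.courant.bracket (A.zeroSection x) c := by
    have h2 := A.zeroSection_add_corePart (A.courant.bracket (A.zeroSection x) c)
    rwa [h.proj_bracket_core, map_zero, zero_add] at h2
  have h2 := h.courantAlgebroid.metric_invariant (A.zeroSection x) c (A.zeroSection y)
  rw [Module.Dual.lie_apply, corePairing_apply, corePairing_apply, h1, hlie]
  linarith

lemma IsVBCourant.bracket_eq (h : A.IsVBCourant)
    (hlie : ∀ x y, A.zeroSection ⁅x, y⁆ = A.courant.bracket (A.zeroSection x) (A.zeroSection y))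
    (d e : 𝔸) : A.courant.bracket d e = A.zeroSection ⁅A.proj d, A.proj e⁆ +
      (A.courant.bracket (A.zeroSection (A.proj d)) (A.coreMap e) -
        A.courant.bracket (A.zeroSection (A.proj e)) (A.coreMap d)) := by
  conv_lhs => rw [zeroSection_proj_add_coreMap (A := A) d, zeroSection_proj_add_coreMap (A := A) e]
  rw [map_add, map_add, LinearMap.add_apply, LinearMap.add_apply, h.bracket_core_core,
    ← hlie, eq_neg_of_add_eq_zero_left
      (h.courantAlgebroid.bracket_add_swap (A.coreMap d : 𝔸) (A.zeroSection (A.proj e)))]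
  abel

/-- The form `β` is the anchor `a` carried to `V*` by the pairing `κ`. The hypothesis `hlie` says
that the Lie bracket of `V` is the one induced on the zero section. -/
lemma IsLACourant.exists_isIso_model (h : A.IsLACourant)
    (hlie : ∀ x y, A.zeroSection ⁅x, y⁆ = A.courant.bracket (A.zeroSection x) (A.zeroSection y)) :
    ∃ β : LinearMap.BilinForm ℝ (Module.Dual ℝ V), β.IsSymm ∧ β.lieInvariant V ∧
      ∃ (Φ : 𝔸 ≃ₗ[ℝ] V × Module.Dual ℝ V) (φ : V ≃ₗ[ℝ] V), A.IsIso (model V β) Φ φ := by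
  have hV := h.vbCourant
  obtain ⟨a, ha⟩ := h.laVectorBundle.exists_coreAnchor
  have hb := h.laVectorBundle.bracket_coreSection
  have hrel {w : (𝔸 × 𝔸) × (𝔸 × 𝔸)} := mem_poissonRelation_iff ha hb (w := w)
  let κ : A.Core ≃ₗ[ℝ] Module.Dual ℝ V :=
    LinearEquiv.ofBijective A.corePairing hV.corePairing_bijective
  have hκ (c : A.Core) : κ c = A.corePairing c := rfl
  have hmem (c : A.Core) :
      (((0 : 𝔸), A.zeroSection (a c)), ((c : 𝔸), (0 : 𝔸))) ∈ A.poissonRelation := by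
    rw [hrel]; simp
  have hmem' (c : A.Core) :
      (((c : 𝔸), (0 : 𝔸)), ((0 : 𝔸), A.zeroSection (a c))) ∈ A.poissonRelation := by
    rw [hrel]; simp
  have hmem₀ (x : V) : ((A.zeroSection x, (0 : 𝔸)), (A.zeroSection x, (0 : 𝔸))) ∈
      A.poissonRelation := by
    rw [hrel]; simp
  have hsymm (c c' : A.Core) : κ c (a c') = κ c' (a c) := by
    -- Orthogonality of these two elements of `Π` is the symmetry of `a`.
    have h1 := (h.courantRelation.lagrangian _).1 (hmem' c) _ (hmem c')
    simp only [MetricBracket.prod, MetricBracket.bar, MetricBracket.tangent,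
      LinearMap.mk₂_apply, LinearMap.neg_apply, map_zero] at h1
    rw [hκ, hκ, corePairing_apply, corePairing_apply,
      hV.courantAlgebroid.metric_symm c' (A.zeroSection _)]
    linarith
  have hequiv (x : V) (c : A.Core) :
      a (A.coreMap (A.courant.bracket (A.zeroSection x) c)) = ⁅x, a c⁆ := by
    -- The bracket has target `(0, 0_⁅x, a c⁆)` and source `([0_x, c], 0)`; the second equation of
    -- `Π` is the equivariance.
    have h1 := h.courantRelation.involutive _ (hmem₀ x) _ (hmem c)
    simp only [MetricBracket.prod, MetricBracket.bar, MetricBracket.tangent,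
      LinearMap.mk₂_apply, hrel, map_zero, LinearMap.zero_apply, add_zero, ← hlie,
      A.proj_zeroSection] at h1
    exact h1.2.1.symm
  let β : LinearMap.BilinForm ℝ (Module.Dual ℝ V) :=
    Module.Dual.eval ℝ V ∘ₗ a ∘ₗ κ.symm.toLinearMap
  have hβ (μ ν : Module.Dual ℝ V) : β μ ν = ν (a (κ.symm μ)) := rfl
  have hsharp (c : A.Core) : sharp β (κ c) = a c := dual_ext fun ν => by
    rw [apply_sharp, hβ, κ.symm_apply_apply]
  have hκlie (x : V) (c : A.Core) :
      κ (A.coreMap (A.courant.bracket (A.zeroSection x) c)) = ⁅x, κ c⁆ :=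
    hV.corePairing_bracket hlie x c
  let Φ : 𝔸 ≃ₗ[ℝ] V × Module.Dual ℝ V :=
    { toFun d := (A.proj d, κ (A.coreMap d))
      map_add' d e := by simp only [map_add, Prod.mk_add_mk]
      map_smul' t d := by simp only [map_smul, RingHom.id_apply, Prod.smul_mk]
      invFun p := A.zeroSection p.1 + κ.symm p.2
      left_inv d := by
        change A.zeroSection (A.proj d) + (κ.symm (κ (A.coreMap d)) : A.Core) = d
        rw [κ.symm_apply_apply]
        exact (zeroSection_proj_add_coreMap (A := A) d).symm
      right_inv p := by simp }
  have hΦ (d : 𝔸) : Φ d = (A.proj d, κ (A.coreMap d)) := rfl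
  refine ⟨β, ⟨fun μ ν => ?_⟩, fun x μ ν => ?_, Φ, LinearEquiv.refl ℝ V, ?_⟩
  · obtain ⟨c, rfl⟩ := κ.surjective μ
    obtain ⟨c', rfl⟩ := κ.surjective ν
    rw [hβ, hβ, κ.symm_apply_apply, κ.symm_apply_apply, hsymm]
  · obtain ⟨c, rfl⟩ := κ.surjective μ
    rw [hβ, hβ, ← hκlie, κ.symm_apply_apply, κ.symm_apply_apply, hequiv, Module.Dual.lie_apply,
      neg_neg]
  refine ⟨fun d => rfl, fun v x y x' y' hx hy => ?_, fun t v x x' hx => ?_,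
    fun d e => ?_, fun d e => ?_, fun d => ?_, ?_⟩
  · rw [hΦ] at hx hy ⊢
    refine Prod.ext ((x + y).2.trans (x' + y').2.symm) ?_
    change κ _ = x'.1.2 + y'.1.2
    rw [← hx, ← hy, A.coreMap_coe_add, map_add]
  · rw [hΦ] at hx ⊢
    refine Prod.ext ((t • x).2.trans (t • x').2.symm) ?_
    change κ _ = t • x'.1.2
    rw [← hx, A.coreMap_coe_smul, map_smul]
  · rw [hV.metric_eq]; rfl
  · rw [hV.bracket_eq hlie d e, hΦ, hΦ, hΦ, map_add, map_add, map_sub, map_sub,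
      A.coreMap_zeroSection, hV.proj_bracket_core, hV.proj_bracket_core, A.proj_zeroSection,
      zero_add, map_sub, hκlie, hκlie, sub_zero, add_zero]
    rfl
  · rw [ha]
    exact hsharp _
  · intro σ τ σ' τ' hσ hτ hσ' hτ' hσσ' hττ' v
    have h1 : (fun v => (σ' v).1.2) = fun v => κ (A.coreMap (σ v : 𝔸)) :=
      funext fun v => (congrArg Prod.snd (hσσ' v)).symm
    have h2 : (fun v => (τ' v).1.2) = fun v => κ (A.coreMap (τ v : 𝔸)) :=
      funext fun v => (congrArg Prod.snd (hττ' v)).symm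
    refine Prod.ext ((A.bracket σ τ v).2.trans ((model V β).bracket σ' τ' v).2.symm) ?_
    change κ _ = ((model V β).bracket σ' τ' v).1.2
    rw [h.laVectorBundle.coreMap_bracket ha hσ hτ, model_bracket, h1, h2]
    have h4 := dirDeriv_linear_comp κ.toLinearMap LinearMap.id (A.isSmoothSection_iff.1 hσ) v
    have h5 := dirDeriv_linear_comp κ.toLinearMap LinearMap.id (A.isSmoothSection_iff.1 hτ) v
    simp only [LinearEquiv.coe_coe, LinearMap.id_apply] at h4 h5
    simp only [actionBracket, hsharp, h4, h5, map_sub]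

end Classification

end Data

end LACourant

theorem mainTheorem11 :
    -- each pair of a Lie algebra and an invariant symmetric form defines an LA-Courant algebroid
    (∀ (𝔤 : Type u) [LieRing 𝔤] [LieAlgebra ℝ 𝔤] [FiniteDimensional ℝ 𝔤]
      (β : LinearMap.BilinForm ℝ (Module.Dual ℝ 𝔤)), β.IsSymm → β.lieInvariant 𝔤 →
      (LACourant.model 𝔤 β).IsLACourant) ∧
    -- every LA-Courant algebroid over a point is of this form
    (∀ (V : Type u) (𝔸 : Type v)
      [AddCommGroup V] [Module ℝ V] [FiniteDimensional ℝ V]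
      [AddCommGroup 𝔸] [Module ℝ 𝔸] [FiniteDimensional ℝ 𝔸]
      (A : LACourant.Data V 𝔸), A.IsLACourant →
      ∃ (𝔤 : Type u) (_ : LieRing 𝔤) (_ : LieAlgebra ℝ 𝔤) (_ : FiniteDimensional ℝ 𝔤)
        (β : LinearMap.BilinForm ℝ (Module.Dual ℝ 𝔤)), β.IsSymm ∧ β.lieInvariant 𝔤 ∧
        ∃ (Φ : 𝔸 ≃ₗ[ℝ] 𝔤 × Module.Dual ℝ 𝔤) (φ : V ≃ₗ[ℝ] 𝔤),
          A.IsIso (LACourant.model 𝔤 β) Φ φ) ∧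
    -- the isomorphisms of the LA-Courant algebroids are those of the pairs
    (∀ (𝔤 : Type u) [LieRing 𝔤] [LieAlgebra ℝ 𝔤] [FiniteDimensional ℝ 𝔤]
      (𝔤' : Type v) [LieRing 𝔤'] [LieAlgebra ℝ 𝔤'] [FiniteDimensional ℝ 𝔤']
      (β : LinearMap.BilinForm ℝ (Module.Dual ℝ 𝔤))
      (β' : LinearMap.BilinForm ℝ (Module.Dual ℝ 𝔤')),
      β.IsSymm → β.lieInvariant 𝔤 → β'.IsSymm → β'.lieInvariant 𝔤' →
      ∀ (Φ : (𝔤 × Module.Dual ℝ 𝔤) ≃ₗ[ℝ] 𝔤' × Module.Dual ℝ 𝔤') (φ : 𝔤 ≃ₗ[ℝ] 𝔤'),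
        (LACourant.model 𝔤 β).IsIso (LACourant.model 𝔤' β') Φ φ ↔
          (∀ x y, φ ⁅x, y⁆ = ⁅φ x, φ y⁆) ∧
          (∀ μ ν : Module.Dual ℝ 𝔤', β' μ ν = β (μ ∘ₗ φ.toLinearMap) (ν ∘ₗ φ.toLinearMap)) ∧
          ∀ x μ, Φ (x, μ) = (φ x, μ ∘ₗ φ.symm.toLinearMap)) ∧
    -- the LA-Dirac structures correspond to the coisotropic Lie subalgebras
    (∀ (𝔤 : Type u) [LieRing 𝔤] [LieAlgebra ℝ 𝔤] [FiniteDimensional ℝ 𝔤]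
      (β : LinearMap.BilinForm ℝ (Module.Dual ℝ 𝔤)), β.IsSymm → β.lieInvariant 𝔤 →
      ∀ L : Set (𝔤 × Module.Dual ℝ 𝔤), (LACourant.model 𝔤 β).IsLADirac L ↔
        ∃! 𝔥 : LieSubalgebra ℝ 𝔤, LACourant.IsCoisotropicSubalgebra β 𝔥 ∧
          L = (𝔥 : Set 𝔤) ×ˢ (𝔥.toSubmodule.dualAnnihilator : Set (Module.Dual ℝ 𝔤))) := by
  refine ⟨?_, ?_, ?_, ?_⟩
  · intro 𝔤 _ _ _ β hs hβ
    exact LACourant.model_isLACourant hs hβ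
  · intro V 𝔸 _ _ _ _ _ _ A hA
    -- With `let`, the additive group and module under the Lie algebra unfold to the given ones, as
    -- `hA` requires.
    let i₁ : LieRing V := hA.vbCourant.lieRing
    let i₂ : LieAlgebra ℝ V := hA.vbCourant.lieAlgebra
    exact ⟨V, i₁, i₂, inferInstance, LACourant.Data.IsLACourant.exists_isIso_model (A := A) hA
      hA.vbCourant.zeroSection_proj_bracket⟩
  · intro 𝔤 _ _ _ 𝔤' _ _ _ β β' _ _ _ _ Φ φ
    exact LACourant.model_isIso_iff
  · intro 𝔤 _ _ _ β _ _ L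
    exact LACourant.model_isLADirac_iff L
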